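/- Let $Q$ be a finite-dimensional smooth ($C^\infty$, Hausdorff, without boundary) manifold, and let $L\colon TQ\times\mathbb{R}\to\mathbb{R}$ be a smooth time-dependent Lagrangian. Let $\mathcal{F}L\colon TQ\times\mathbb{R}\to T^*Q\times\mathbb{R}$ be its Legendre transformation, given in induced coordinates by $\mathcal{F}L(x^i,\dot x^i,t)=(x^i,\partial L/\partial\dot x^i,t)$, and assume that $L$ is hyperregular, that is, that $\mathcal{F}L$ is a diffeomorphism. Let $E_L=\dot x^i\,\partial L/\partial\dot x^i-L$ be the energy and $H=E_L\circ(\mathcal{F}L)^{-1}\colon T^*Q\times\mathbb{R}\to\mathbb{R}$ the Hamiltonian. Let $\theta_Q=p_i\,\mathrm{d}x^i$ be the Liouville $1$-form on $T^*Q$ and $\omega_Q=-\mathrm{d}\theta_Q$ the canonical symplectic form, and on $T^*Q\times\mathbb{R}$ put $$\eta=\mathrm{pr}_2^*\mathrm{d}t,\qquad \Omega_H=-\mathrm{d}(\mathrm{pr}_1^*\theta_Q-H\eta).$$ Let $E_H$ be the evolution vector field on $T^*Q\times\mathbb{R}$, determined by $i_{E_H}\Omega_H=0$ and $i_{E_H}\eta=1$.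 For $s\in\mathbb{R}$ let $\Psi_s\colon\mathcal{U}\to T^*Q\times\mathbb{R}$ be the time-$s$ map of the (maximal) flow of $E_H$, where $\mathcal{U}=\mathcal{U}^{(s)}\subseteq T^*Q\times\mathbb{R}$ is the set of all points from which the integral curve of $E_H$ is defined up to time $s$. For $t\in\mathbb{R}$ put $\mathcal{U}_t=\{\alpha\in T^*Q : (\alpha,t)\in\mathcal{U}\}$ and $$\Psi_{t,s}\colon\mathcal{U}_t\to T^*Q,\qquad \Psi_{t,s}(\alpha)=\mathrm{pr}_1(\Psi_s(\alpha,t)).$$ **Theorem.** For all $t,s\in\mathbb{R}$, the map $\Psi_{t,s}\colon\mathcal{U}_t\subseteq T^*Q\to T^*Q$ is a symplectomorphism onto its image: $\mathcal{U}_t$ is open, $\Psi_{t,s}$ is a $C^\infty$ diffeomorphism from $\mathcal{U}_t$ onto an open subset of $T^*Q$, and $\Psi_{t,s}^*\omega_Q=\omega_Q$ on $\mathcal{U}_t$. -/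

import Mathlib

open Set
open scoped Manifold ContDiff Bundle

noncomputable section

/-! ### Differential forms and flows on a boundaryless manifold -/

section Forms

variable {E : Type*} [NormedAddCommGroup E] [NormedSpace ℝ E]
  {H : Type*} [TopologicalSpace H] (I : ModelWithCorners ℝ E H)
  {M : Type*} [TopologicalSpace M] [ChartedSpace H M]
  {E' : Type*} [NormedAddCommGroup E'] [NormedSpace ℝ E']
  {H' : Type*} [TopologicalSpace H'] (I' : ModelWithCorners ℝ E' H')
  {N : Type*} [TopologicalSpace N] [ChartedSpace H' N]

variable (M) in
/-- A (not necessarily continuous) differential `k`-form on the manifold `M`. -/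
abbrev DiffForm (k : ℕ) : Type _ :=
  ∀ x : M, TangentSpace I x [⋀^Fin k]→L[ℝ] ℝ

variable {I} in
/-- The differential `1`-form given by a field of covectors. -/
def oneForm (a : ∀ x : M, TangentSpace I x →L[ℝ] ℝ) : DiffForm I M 1 :=
  fun x ↦ ContinuousAlternatingMap.ofSubsingleton ℝ (TangentSpace I x) ℝ (0 : Fin 1) (a x)

variable {I I'} in
/-- The pullback `f^* σ` of a differential form along a map of manifolds. -/
def DiffForm.pullback {k : ℕ} (f : M → N) (σ : DiffForm I' N k) : DiffForm I M k :=
  fun x ↦ (σ (f x)).compContinuousLinearMap (mfderiv I I' f x)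

variable {I} in
/-- The expression of the differential form `σ` in the preferred chart at `x`: the pullback of `σ`
along the inverse of that chart. -/
def DiffForm.inChart {k : ℕ} (σ : DiffForm I M k) (x : M) : E → E [⋀^Fin k]→L[ℝ] ℝ :=
  DiffForm.pullback (I := 𝓘(ℝ, E)) (extChartAt I x).symm σ

variable {I} in
/-- The exterior derivative of a differential form on a boundaryless manifold: at `x` it is the
exterior derivative of the expression of the form in the preferred chart at `x`, pulled back to the
manifold along this chart. -/
def DiffForm.extd {k : ℕ} (σ : DiffForm I M k) : DiffForm I M (k + 1) :=
  fun x ↦ ContinuousAlternatingMap.compContinuousLinearMap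
    (extDeriv (DiffForm.inChart σ x) (extChartAt I x x) : E [⋀^Fin (k + 1)]→L[ℝ] ℝ)
    (mfderiv I 𝓘(ℝ, E) (extChartAt I x) x)

variable {I} in
/-- The domain of the time-`s` map of the maximal flow of the vector field `X`: the points from
which an integral curve of `X` exists on an open interval containing both `0` and `s`. -/
def flowDomain (X : ∀ x : M, TangentSpace I x) (s : ℝ) : Set M :=
  {x | ∃ (γ : ℝ → M) (a b : ℝ), 0 ∈ Ioo a b ∧ s ∈ Ioo a b ∧ γ 0 = x ∧
    IsMIntegralCurveOn γ X (Ioo a b)}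

open Classical in
variable {I} in
/-- The time-`s` map of the maximal flow of the vector field `X`: a point of `flowDomain X s` is
sent to the value at time `s` of the integral curve of `X` through it. (Points outside the domain
are left where they are; this is a junk value.) -/
def flow (X : ∀ x : M, TangentSpace I x) (s : ℝ) (x : M) : M :=
  if h : x ∈ flowDomain X s then Classical.choose h s else x

/-- `f` restricts on `U` to a symplectomorphism with respect to the `2`-form `σ`: the set `U` is
open, `f` is a smooth diffeomorphism from `U` onto an open set, and `f^* σ = σ` on `U`. -/
def IsSymplectomorphismOn (σ : DiffForm I M 2) (f : M → M) (U : Set M) : Prop :=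
  (∃ e : OpenPartialHomeomorph M M, e.source = U ∧ EqOn f e U ∧
    ContMDiffOn I I ∞ e e.source ∧ ContMDiffOn I I ∞ e.symm e.target) ∧
  ∀ x ∈ U, DiffForm.pullback f σ x = σ x

end Forms

/-! ### The cotangent bundle and time-dependent mechanics -/

section Mechanics

variable (E : Type*) [NormedAddCommGroup E] [NormedSpace ℝ E]
  (Q : Type*) [TopologicalSpace Q] [ChartedSpace E Q] [IsManifold 𝓘(ℝ, E) ∞ Q]

/-- The cotangent bundle `T^*Q`, as the bundle of continuous linear maps from the tangent bundle to
the trivial line bundle, with the topology and the charts that Mathlib gives to such a bundle. -/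
abbrev CotangentBundle : Type _ :=
  Bundle.TotalSpace (E →L[ℝ] ℝ)
    (fun x : Q ↦ TangentSpace 𝓘(ℝ, E) x →L[ℝ] Bundle.Trivial Q ℝ x)

/-- The model with corners of `TQ × ℝ`. -/
abbrev modelTQR := (𝓘(ℝ, E).tangent).prod 𝓘(ℝ, ℝ)

/-- The model with corners of `T^*Q`. -/
abbrev modelTsQ := (𝓘(ℝ, E)).prod 𝓘(ℝ, E →L[ℝ] ℝ)

/-- The model with corners of `T^*Q × ℝ`. -/
abbrev modelTsQR := (modelTsQ E).prod 𝓘(ℝ, ℝ)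

variable {E Q}

/-- The fibre derivative `w ↦ d/dε L(q, v + ε w, t)|_{ε = 0}` of a time-dependent Lagrangian. -/
def fibreDeriv (L : TangentBundle 𝓘(ℝ, E) Q × ℝ → ℝ) (z : TangentBundle 𝓘(ℝ, E) Q × ℝ) :
    TangentSpace 𝓘(ℝ, E) z.1.proj →L[ℝ] ℝ :=
  fderiv ℝ (fun v : TangentSpace 𝓘(ℝ, E) z.1.proj ↦ L (⟨z.1.proj, v⟩, z.2)) z.1.snd

/-- The Legendre transformation `(x, v, t) ↦ (x, ∂L/∂v, t)`. -/
def legendre (L : TangentBundle 𝓘(ℝ, E) Q × ℝ → ℝ) (z : TangentBundle 𝓘(ℝ, E) Q × ℝ) :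
    CotangentBundle E Q × ℝ :=
  (⟨z.1.proj, fibreDeriv L z⟩, z.2)

/-- The energy `E_L = v · ∂L/∂v - L`. -/
def energy (L : TangentBundle 𝓘(ℝ, E) Q × ℝ → ℝ) (z : TangentBundle 𝓘(ℝ, E) Q × ℝ) : ℝ :=
  fibreDeriv L z z.1.snd - L z

/-- `L` is hyperregular: its Legendre transformation is a (smooth) diffeomorphism
from `TQ × ℝ` onto `T^*Q × ℝ`. -/
def IsHyperregular (L : TangentBundle 𝓘(ℝ, E) Q × ℝ → ℝ) : Prop :=
  ∃ Φ : Diffeomorph (modelTQR E) (modelTsQR E)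
      (TangentBundle 𝓘(ℝ, E) Q × ℝ) (CotangentBundle E Q × ℝ) ∞,
    ∀ z, Φ z = legendre L z

/-- The Hamiltonian `H = E_L ∘ (FL)⁻¹` of a hyperregular Lagrangian. -/
def hamiltonian (L : TangentBundle 𝓘(ℝ, E) Q × ℝ → ℝ) (hL : IsHyperregular L) :
    CotangentBundle E Q × ℝ → ℝ :=
  fun y ↦ energy L ((Classical.choose hL).symm y)

variable (E Q) in
/-- The Liouville `1`-form on `T^*Q`: `θ_α(W) = α(Tπ W)`. -/
def liouvilleForm : DiffForm (modelTsQ E) (CotangentBundle E Q) 1 :=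
  oneForm fun α ↦
    (α.snd : TangentSpace 𝓘(ℝ, E) α.proj →L[ℝ] ℝ).comp
      (mfderiv (modelTsQ E) 𝓘(ℝ, E) (fun β : CotangentBundle E Q ↦ β.proj) α)

variable (E Q) in
/-- The canonical symplectic form `ω_Q = -dθ_Q` on `T^*Q`. -/
def symplecticForm : DiffForm (modelTsQ E) (CotangentBundle E Q) 2 :=
  fun α ↦ -DiffForm.extd (liouvilleForm E Q) α

/-- The `1`-form `dt` on `ℝ`. -/
def dtForm : DiffForm 𝓘(ℝ, ℝ) ℝ 1 :=
  oneForm fun _ ↦ ContinuousLinearMap.id ℝ ℝ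

variable (E Q) in
/-- The `1`-form `η = pr₂^* dt` on `T^*Q × ℝ`. -/
def etaForm : DiffForm (modelTsQR E) (CotangentBundle E Q × ℝ) 1 :=
  DiffForm.pullback (Prod.snd : CotangentBundle E Q × ℝ → ℝ) dtForm

/-- The `2`-form `Ω_H = -d(pr₁^* θ_Q - H η)` on `T^*Q × ℝ`. -/
def omegaForm (H : CotangentBundle E Q × ℝ → ℝ) :
    DiffForm (modelTsQR E) (CotangentBundle E Q × ℝ) 2 :=
  fun y ↦ -(DiffForm.extd (fun z ↦
    DiffForm.pullback (I := modelTsQR E) (Prod.fst : CotangentBundle E Q × ℝ → CotangentBundle E Q)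
      (liouvilleForm E Q) z - H z • etaForm E Q z) y)

/-- The evolution vector field `E_H` on `T^*Q × ℝ`, whose value at `y` is the tangent vector `v`
determined by `i_v Ω_H = 0` and `i_v η = 1`. -/
def evolutionField (H : CotangentBundle E Q × ℝ → ℝ) (y : CotangentBundle E Q × ℝ) :
    TangentSpace (modelTsQR E) y :=
  Classical.epsilon fun v : TangentSpace (modelTsQR E) y ↦
    (∀ w : TangentSpace (modelTsQR E) y, omegaForm H y ![v, w] = 0) ∧ etaForm E Q y ![v] = 1

/-- The set `U_t` of all `α` in `T^*Q` such that `(α, t)` lies in the domain of the time-`s` map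
of the flow of `E_H`. -/
def fibreDomain (H : CotangentBundle E Q × ℝ → ℝ) (t s : ℝ) : Set (CotangentBundle E Q) :=
  {α | (α, t) ∈ flowDomain (evolutionField H) s}

/-- The map `Ψ_{t,s}(α) = pr₁(Ψ_s(α, t))`, where `Ψ` is the flow of `E_H`. -/
def fibreFlow (H : CotangentBundle E Q × ℝ → ℝ) (t s : ℝ) (α : CotangentBundle E Q) :
    CotangentBundle E Q :=
  (flow (evolutionField H) s (α, t)).1

end Mechanics

end

/-! ### Smoothness of evolution flows and invariance of the canonical symplectic form -/

/-! The Hamiltonian is smooth, because hyperregularity makes the fibre derivative of `L` smooth and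
gives a smooth inverse of the Legendre map. The argument then rests on three facts. In canonical
coordinates `Ω_H = dx ∧ dp + dH ∧ dt`, and the conditions on `E_H` are Hamilton's equations together
with `dt/dτ = 1` (`eq_hamiltonVector_iff`, `evolution_condition_iff`). So `E_H` exists, is unique
and is smooth. A closed 2-form annihilated by a vector field is invariant under its flow: by
Cartan's formula `L_X Ω = d i_X Ω + i_X dΩ = 0` (`lie_invariance`, `flow_pullback_eq`). Smooth
dependence on initial conditions comes from the implicit function theorem in a space of continuous
curves (`exists_smooth_local_flow`). Openness of the domain, smoothness and invariance are carried
to any time by connectedness of the time interval (`eventually_flowPreservesAt`). Let `j_t α = (α,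
t)`. Time advances at unit rate, so `Ψ_s ∘ j_t = j_{t+s} ∘ Ψ_{t,s}`, while `j_t^* Ω_H = ω_Q` since
`dt` vanishes on slices (`pullback_omegaForm`). Pulling `Ω_H` back along both sides gives `Ψ_{t,s}^*
ω_Q = ω_Q`, and `Ψ_{t+s,-s}` is the smooth inverse. -/

noncomputable section

open Topology Filter

/-! ### Smoothness of composition operators on spaces of continuous curves. -/

section Superposition

set_option synthInstance.maxHeartbeats 200000

universe u

variable {K : Type*} [TopologicalSpace K] [CompactSpace K]

/-- The superposition operator `γ ↦ f ∘ γ` on continuous functions. -/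
def superposition {F G : Type*} [TopologicalSpace F] [TopologicalSpace G] (f : C(F, G)) :
    C(K, F) → C(K, G) := fun γ ↦ f.comp γ

/-- The bilinear map `(A, h) ↦ (k ↦ B (A k) (h k))` on continuous functions. -/
def pointwiseBilin (K : Type*) [TopologicalSpace K] [CompactSpace K] {P F G : Type*}
    [NormedAddCommGroup P] [NormedSpace ℝ P] [NormedAddCommGroup F] [NormedSpace ℝ F]
    [NormedAddCommGroup G] [NormedSpace ℝ G] (B : P →L[ℝ] F →L[ℝ] G) :
    C(K, P) →L[ℝ] C(K, F) →L[ℝ] C(K, G) :=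
  LinearMap.mkContinuous₂
    (LinearMap.mk₂ ℝ (fun (A : C(K, P)) (h : C(K, F)) ↦
        (⟨fun k ↦ B (A k) (h k), by fun_prop⟩ : C(K, G)))
      (fun _ _ _ ↦ by ext; simp) (fun _ _ _ ↦ by ext; simp)
      (fun _ _ _ ↦ by ext; simp) (fun _ _ _ ↦ by ext; simp))
    ‖B‖ (fun A h ↦ by
      rw [ContinuousMap.norm_le _ (by positivity)]
      intro k
      refine (B.le_opNorm₂ (A k) (h k)).trans ?_
      gcongr
      exacts [A.norm_coe_le_norm k, h.norm_coe_le_norm k])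

/-- Continuity of `γ ↦ f' ∘ γ` in the sup norm makes the derivative of `f` vary little near `γ k`,
uniformly in `k`. The mean value inequality on balls then gives a uniform remainder estimate. -/
theorem hasFDerivAt_superposition {P F G : Type*} [NormedAddCommGroup P] [NormedSpace ℝ P]
    [NormedAddCommGroup F] [NormedSpace ℝ F] [NormedAddCommGroup G] [NormedSpace ℝ G]
    (B : P →L[ℝ] F →L[ℝ] G) (f : C(F, G)) (f' : C(F, P))
    (hf : ∀ x, HasFDerivAt f (B (f' x)) x) (γ : C(K, F)) :
    HasFDerivAt (superposition (K := K) f)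
      (pointwiseBilin K B (superposition f' γ)) γ := by
  rw [hasFDerivAt_iff_isLittleO_nhds_zero, Asymptotics.isLittleO_iff]
  intro c hc
  have hcont : Continuous (superposition (K := K) f') := ContinuousMap.continuous_postcomp f'
  have h1 := Metric.continuousAt_iff.1 (hcont.continuousAt (x := γ)) (c / (‖B‖ + 1))
    (by positivity)
  obtain ⟨δ, hδ, h1⟩ := h1
  -- the same bound holds pointwise, for points that move by less than `δ`
  have h2 : ∀ k : K, ∀ z : F, ‖z - γ k‖ < δ → ‖B (f' z) - B (f' (γ k))‖ ≤ c := by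
    intro k z hz
    -- The perturbation by the constant `z - γ k` takes the value `z` at `k` and has sup norm at
    -- most `‖z - γ k‖`.
    have h3 : dist (γ + ContinuousMap.const K (z - γ k)) γ < δ := by
      rw [dist_eq_norm, add_sub_cancel_left]
      exact lt_of_le_of_lt ((ContinuousMap.norm_le _ (norm_nonneg _)).2 fun _ ↦ le_rfl) hz
    have h4 := h1 h3
    rw [dist_eq_norm] at h4
    have h5 := (ContinuousMap.norm_coe_le_norm (superposition f'
      (γ + ContinuousMap.const K (z - γ k)) - superposition f' γ) k).trans h4.le
    have h6 : ‖f' z - f' (γ k)‖ ≤ c / (‖B‖ + 1) := by simpa [superposition] using h5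
    rw [← map_sub]
    refine (B.le_opNorm _).trans ((mul_le_mul_of_nonneg_left h6 (norm_nonneg B)).trans ?_)
    rw [mul_div_assoc', div_le_iff₀ (by positivity)]
    nlinarith [norm_nonneg B]
  filter_upwards [Metric.ball_mem_nhds (0 : C(K, F)) hδ] with h hh
  rw [mem_ball_zero_iff] at hh
  rw [ContinuousMap.norm_le _ (by positivity)]
  intro k
  have hk : ‖h k‖ < δ := (h.norm_coe_le_norm k).trans_lt hh
  have h6 := (convex_ball (γ k) δ).norm_image_sub_le_of_norm_hasFDerivWithin_le'
    (f := f) (f' := fun z ↦ B (f' z)) (φ := B (f' (γ k))) (C := c)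
    (fun z _ ↦ (hf z).hasFDerivWithinAt)
    (fun z hz ↦ h2 k z (by simpa [dist_eq_norm] using hz))
    (Metric.mem_ball_self hδ) (show γ k + h k ∈ Metric.ball (γ k) δ by simpa using hk)
  rw [add_sub_cancel_left] at h6
  exact h6.trans (by gcongr; exact h.norm_coe_le_norm k)

/-- The derivative is again a superposition operator, that of `fderiv ℝ f`, followed by a continuous
linear map. Its values lie in `F →L[ℝ] G`, so the induction must range over all `G`, and the common
universe keeps this new target admissible. -/
theorem contDiff_superposition_nat {F : Type u} [NormedAddCommGroup F] [NormedSpace ℝ F] (n : ℕ) :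
    ∀ {G : Type u} [NormedAddCommGroup G] [NormedSpace ℝ G] (f : C(F, G)), ContDiff ℝ ∞ f →
      ContDiff ℝ n (superposition (K := K) f) := by
  induction n with
  | zero =>
    intro G _ _ f hf
    exact contDiff_zero.2 (ContinuousMap.continuous_postcomp f)
  | succ n ih =>
    intro G _ _ f hf
    have hf' : ContDiff ℝ ∞ (fderiv ℝ f) := hf.fderiv_right (by simp)
    rw [Nat.cast_add, Nat.cast_one, contDiff_succ_iff_hasFDerivAt]
    refine ⟨_, ?_, fun γ ↦ hasFDerivAt_superposition (.id ℝ (F →L[ℝ] G)) f ⟨fderiv ℝ f, hf'.continuous⟩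
      (fun x ↦ (hf.differentiable (by simp) x).hasFDerivAt) γ⟩
    exact (pointwiseBilin K (.id ℝ (F →L[ℝ] G))).contDiff.comp (ih ⟨fderiv ℝ f, hf'.continuous⟩ hf')

theorem contDiff_superposition {F : Type*} [NormedAddCommGroup F] [NormedSpace ℝ F]
    (f : C(F, F)) (hf : ContDiff ℝ ∞ f) : ContDiff ℝ ∞ (superposition (K := K) f) :=
  contDiff_infty.2 fun n ↦ contDiff_superposition_nat n f hf

end Superposition

/-! ### Local flows and the variational equation by the implicit function theorem. -/

section LocalFlow

/-- Being `C^∞` at the base point does not by itself give a neighbourhood on which `ψ` is `C^∞`.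
Invertibility of the partial derivative is an open condition, so the implicit function theorem
applies again at each nearby `(x, ψ x)`, and local uniqueness identifies its solution with `ψ`. -/
theorem exists_contDiffAt_implicit {E₁ E₂ G : Type*}
    [NormedAddCommGroup E₁] [NormedSpace ℝ E₁] [CompleteSpace E₁]
    [NormedAddCommGroup E₂] [NormedSpace ℝ E₂] [CompleteSpace E₂]
    [NormedAddCommGroup G] [NormedSpace ℝ G] [CompleteSpace G]
    {f : E₁ × E₂ → G} (hf : ContDiff ℝ ∞ f) {u : E₁ × E₂}
    (hu : (fderiv ℝ f u ∘L .inr ℝ E₁ E₂).IsInvertible) :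
    ∃ ψ : E₁ → E₂, ψ u.1 = u.2 ∧ ∀ᶠ x in 𝓝 u.1, ContDiffAt ℝ ∞ ψ x ∧ f (x, ψ x) = f u := by
  have hn : (∞ : WithTop ℕ∞) ≠ 0 := by simp
  set ψ := (hf.contDiffAt (x := u)).implicitFunction hn hu with hψ
  have h0 : ψ u.1 = u.2 := ContDiffAt.implicitFunction_apply_self _ hn hu
  have h1 : ContDiffAt ℝ ∞ ψ u.1 := ContDiffAt.contDiffAt_implicitFunction _ hn hu
  have h2 : ∀ᶠ x in 𝓝 u.1, f (x, ψ x) = f u := ContDiffAt.eventually_apply_implicitFunction _ hn hu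
  have h3 : ∀ᶠ x in 𝓝 u.1, ContinuousAt ψ x :=
    ((h1.of_le (m := 1) (by simp)).eventually (by simp)).mono fun _ h ↦ h.continuousAt
  have h4 : ∀ᶠ x in 𝓝 u.1, (fderiv ℝ f (x, ψ x) ∘L .inr ℝ E₁ E₂).IsInvertible := by
    obtain ⟨e, he⟩ := hu
    have hc : ContinuousAt (fun x ↦ fderiv ℝ f (x, ψ x) ∘L .inr ℝ E₁ E₂) u.1 :=
      (((hf.continuous_fderiv (by simp)).continuousAt (x := (u.1, ψ u.1))).comp
        (f := fun x ↦ (x, ψ x)) (continuousAt_id.prodMk h1.continuousAt)).clm_comp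
          continuousAt_const
    have he' : fderiv ℝ f (u.1, ψ u.1) ∘L .inr ℝ E₁ E₂ = e := by rw [h0]; exact he.symm
    have hmem := hc.preimage_mem_nhds (t := range ((↑) : (E₂ ≃L[ℝ] G) → E₂ →L[ℝ] G))
      (by rw [he']; exact e.nhds)
    filter_upwards [hmem] with x hx
    exact hx
  refine ⟨ψ, h0, ?_⟩
  filter_upwards [h2.eventually_nhds, h3, h4] with x hx2 hx3 hx4
  refine ⟨?_, hx2.self_of_nhds⟩
  have h5 := ContDiffAt.contDiffAt_implicitFunction (hf.contDiffAt (x := (x, ψ x))) hn hx4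
  refine h5.congr_of_eventuallyEq ?_
  have h6 := ContDiffAt.eventually_apply_eq_iff_implicitFunction
    (hf.contDiffAt (x := (x, ψ x))) hn hx4
  have h7 := (continuousAt_id.prodMk hx3 : ContinuousAt (fun y ↦ (y, ψ y)) x).eventually h6
  filter_upwards [h7, hx2] with y hy hy2
  exact (hy.1 (hy2.trans hx2.self_of_nhds.symm)).symm

/-- The compact time interval on which local flows are constructed. -/
abbrev TimeInterval : Type := Icc (-1 : ℝ) 1

/-- The retraction of the line onto the time interval. -/
def clampTime (s : ℝ) : TimeInterval := projIcc (-1) 1 (by norm_num) s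

theorem continuous_clampTime : Continuous clampTime :=
  continuous_projIcc (h := by norm_num)

theorem coe_clampTime_of_mem {s : ℝ} (hs : s ∈ Icc (-1 : ℝ) 1) : (clampTime s : ℝ) = s := by
  simp [clampTime, projIcc_of_mem _ hs]

variable {F : Type*} [NormedAddCommGroup F] [NormedSpace ℝ F]

/-- Integration from `0`, as an operator on continuous curves. -/
def integralCurveOp (F : Type*) [NormedAddCommGroup F] [NormedSpace ℝ F] :
    C(TimeInterval, F) →L[ℝ] C(TimeInterval, F) :=
  LinearMap.mkContinuous
    { toFun := fun g ↦ ⟨fun τ ↦ ∫ s in (0 : ℝ)..τ, g (clampTime s),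
        (intervalIntegral.continuous_primitive
          (fun a b ↦ (g.continuous.comp continuous_clampTime).intervalIntegrable a b) 0).comp
          continuous_subtype_val⟩
      map_add' := fun g h ↦ by
        ext τ
        exact intervalIntegral.integral_add
          ((g.continuous.comp continuous_clampTime).intervalIntegrable _ _)
          ((h.continuous.comp continuous_clampTime).intervalIntegrable _ _)
      map_smul' := fun c g ↦ by
        ext τ
        exact intervalIntegral.integral_smul c _ }
    1 fun g ↦ by
      rw [one_mul, ContinuousMap.norm_le _ (norm_nonneg _)]
      intro τ
      refine (intervalIntegral.norm_integral_le_of_norm_le_const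
        (C := ‖g‖) fun s _ ↦ g.norm_coe_le_norm _).trans ?_
      have : |(τ : ℝ) - 0| ≤ 1 := by
        rw [sub_zero, abs_le]
        exact τ.2
      exact mul_le_of_le_one_right (norm_nonneg _) this

theorem integralCurveOp_apply (g : C(TimeInterval, F)) (τ : TimeInterval) :
    integralCurveOp F g τ = ∫ s in (0 : ℝ)..τ, g (clampTime s) := rfl

/-- The factor `ε` in the integral equation cancels the `1 / ε` from rescaling time to `[-1, 1]`;
the clamping is the identity at these times. -/
theorem hasDerivAt_of_eq_integralCurveOp [CompleteSpace F] {g h : C(TimeInterval, F)}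
    {x : F} {ε : ℝ} (hε : 0 < ε)
    (hg : g = ContinuousMap.const _ x + ε • integralCurveOp F h) {τ : ℝ} (hτ : τ ∈ Ioo (-ε) ε) :
    HasDerivAt (fun τ ↦ g (clampTime (τ / ε))) (h (clampTime (τ / ε))) τ := by
  have hcont : Continuous fun s ↦ h (clampTime s) := h.continuous.comp continuous_clampTime
  have h1 := (intervalIntegral.integral_hasDerivAt_right (hcont.intervalIntegrable 0 (τ / ε))
    (hcont.stronglyMeasurableAtFilter _ _) hcont.continuousAt)
  have h2 : HasDerivAt (fun τ ↦ x + ε • ∫ s in (0 : ℝ)..(τ / ε), h (clampTime s))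
      (ε • ((1 / ε) • h (clampTime (τ / ε)))) τ :=
    ((HasDerivAt.scomp (g₁ := fun u : ℝ ↦ ∫ s in (0 : ℝ)..u, h (clampTime s)) τ h1
      ((hasDerivAt_id τ).div_const ε)).const_smul ε).const_add x
  rw [smul_smul, mul_one_div_cancel hε.ne', one_smul] at h2
  refine h2.congr_of_eventuallyEq ?_
  filter_upwards [Ioo_mem_nhds hτ.1 hτ.2] with σ hσ
  have hσ' : σ / ε ∈ Icc (-1 : ℝ) 1 :=
    ⟨by rw [le_div_iff₀ hε]; linarith [hσ.1], by rw [div_le_iff₀ hε]; linarith [hσ.2]⟩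
  rw [hg]
  simp [integralCurveOp_apply, coe_clampTime_of_mem hσ']

/-- After rescaling time, an integral curve from `x` solves `γ = x + ε ∫ f ∘ γ` on `[-1, 1]`. At `ε
= 0` the linearisation in `γ` is the identity, so the solution depends smoothly on `(ε, x)`; one
small `ε` is then fixed. The global smoothness of `f` is what makes the superposition operator
smooth on the whole curve space. -/
theorem exists_smooth_local_flow [CompleteSpace F] {f : F → F} (hf : ContDiff ℝ ∞ f) (x₀ : F)
    {V : Set F} (hV : V ∈ 𝓝 x₀) :
    ∃ ε > 0, ∃ U : Set F, IsOpen U ∧ x₀ ∈ U ∧ ∃ φ : ℝ → F → F, ∀ x ∈ U, φ 0 x = x ∧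
      ∀ τ ∈ Ioo (-ε) ε, φ τ x ∈ V ∧ ContDiffAt ℝ ∞ (φ τ) x ∧
        HasDerivAt (fun τ ↦ φ τ x) (f (φ τ x)) τ ∧
        ∀ v, HasDerivAt (fun τ ↦ fderiv ℝ (φ τ) x v)
          (fderiv ℝ f (φ τ x) (fderiv ℝ (φ τ) x v)) τ := by
  set S := superposition (K := TimeInterval) ⟨f, hf.continuous⟩ with hSdef
  have hS : ContDiff ℝ ∞ S := contDiff_superposition _ hf
  have hDf : Continuous (fderiv ℝ f) := hf.continuous_fderiv (by simp)
  let c : F →L[ℝ] C(TimeInterval, F) := ContinuousLinearMap.const ℝ TimeInterval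
  let Φ : (ℝ × F) × C(TimeInterval, F) → C(TimeInterval, F) := fun u ↦
    u.2 - c u.1.2 - u.1.1 • integralCurveOp F (S u.2)
  have hΦ : ContDiff ℝ ∞ Φ := by
    refine (contDiff_snd.sub (c.contDiff.comp (contDiff_snd.comp contDiff_fst))).sub ?_
    exact (contDiff_fst.comp contDiff_fst).smul
      ((integralCurveOp F).contDiff.comp (hS.comp contDiff_snd))
  have hu : (fderiv ℝ Φ ((0, x₀), c x₀) ∘L .inr ℝ (ℝ × F) C(TimeInterval, F)).IsInvertible := by
    refine ⟨ContinuousLinearEquiv.refl ℝ _, ?_⟩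
    have h1 : HasFDerivAt (fun γ ↦ Φ ((0, x₀), γ))
        (fderiv ℝ Φ ((0, x₀), c x₀) ∘L .inr ℝ (ℝ × F) C(TimeInterval, F)) (c x₀) :=
      ((hΦ.differentiable (by simp)) _).hasFDerivAt.comp (c x₀) (hasFDerivAt_prodMk_right _ _)
    have h2 : HasFDerivAt (fun γ ↦ Φ ((0, x₀), γ)) (ContinuousLinearMap.id ℝ _) (c x₀) := by
      have : (fun γ ↦ Φ ((0, x₀), γ)) = fun γ ↦ γ - c x₀ := by
        funext γ; simp [Φ]
      rw [this]
      exact (hasFDerivAt_id _).sub_const _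
    exact h2.unique h1
  obtain ⟨ψ, hψ0, hψ⟩ := exists_contDiffAt_implicit hΦ hu
  have hψc : ContinuousAt ψ (0, x₀) := hψ.self_of_nhds.1.continuousAt
  have hψV : ∀ᶠ p in 𝓝 ((0 : ℝ), x₀), ∀ τ, ψ p τ ∈ V := by
    obtain ⟨δ, hδ, hball⟩ := Metric.mem_nhds_iff.1 hV
    have hψ0' : ψ (0, x₀) = c x₀ := hψ0
    have := hψc.eventually (Metric.ball_mem_nhds _ hδ)
    filter_upwards [this] with p hp τ
    apply hball
    rw [hψ0', dist_eq_norm] at hp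
    rw [Metric.mem_ball, dist_eq_norm]
    exact lt_of_le_of_lt ((ψ p - c x₀).norm_coe_le_norm τ) hp
  obtain ⟨A, U, hAo, hA0, hUo, hU0, hAU⟩ := mem_nhds_prod_iff'.1 (hψ.and hψV)
  have hA : A ∈ 𝓝 (0 : ℝ) := hAo.mem_nhds hA0
  obtain ⟨ε, hε, hεA⟩ : ∃ ε > 0, ε ∈ A := by
    obtain ⟨δ, hδ, hball⟩ := Metric.mem_nhds_iff.1 hA
    exact ⟨δ / 2, by positivity, hball (by simp [abs_of_pos hδ, hδ])⟩
  have hsmooth : ∀ x ∈ U, ContDiffAt ℝ ∞ (fun x ↦ ψ (ε, x)) x := fun x hx ↦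
    ((hAU (mk_mem_prod hεA hx)).1.1).comp x (contDiffAt_const.prodMk contDiffAt_id)
  have hfix : ∀ x ∈ U, ψ (ε, x) = c x + ε • integralCurveOp F (S (ψ (ε, x))) := by
    intro x hx
    have h1 := (hAU (mk_mem_prod hεA hx)).1.2
    have h2 : Φ ((0, x₀), c x₀) = 0 := by simp [Φ]
    rw [h2] at h1
    simp only [Φ] at h1
    rw [sub_sub, sub_eq_zero] at h1
    exact h1
  refine ⟨ε, hε, U, hUo, hU0, fun τ x ↦ ψ (ε, x) (clampTime (τ / ε)), fun x hx ↦ ⟨?_, ?_⟩⟩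
  · simp only [zero_div]
    rw [hfix x hx]
    have h0 : (clampTime 0 : ℝ) = 0 := coe_clampTime_of_mem (by norm_num)
    simp [integralCurveOp_apply, h0, c]
  intro τ hτ
  refine ⟨(hAU (mk_mem_prod hεA hx)).2 _, ?_, hasDerivAt_of_eq_integralCurveOp hε (hfix x hx) hτ, ?_⟩
  · exact (ContinuousMap.evalCLM ℝ (clampTime (τ / ε))).contDiff.contDiffAt.comp x (hsmooth x hx)
  intro v
  set W : F →L[ℝ] C(TimeInterval, F) := fderiv ℝ (fun x ↦ ψ (ε, x)) x with hW
  have hWd : HasFDerivAt (fun x ↦ ψ (ε, x)) W x :=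
    ((hsmooth x hx).differentiableAt (by simp)).hasFDerivAt
  have hev : ∀ τ, fderiv ℝ (fun x ↦ ψ (ε, x) (clampTime (τ / ε))) x v = W v (clampTime (τ / ε)) := by
    intro τ
    have := ((ContinuousMap.evalCLM ℝ (clampTime (τ / ε))).hasFDerivAt.comp x hWd).fderiv
    exact congrArg (fun T : F →L[ℝ] F ↦ T v) this
  have hSd := (hasFDerivAt_superposition (.id ℝ (F →L[ℝ] F)) ⟨f, hf.continuous⟩ ⟨fderiv ℝ f, hDf⟩
    (fun x ↦ (hf.differentiable (by simp) x).hasFDerivAt) (ψ (ε, x))).comp x hWd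
  -- Differentiating the integral equation in the direction `v` gives the linear integral equation
  -- whose differential form is the variational equation.
  have hWfix : W v = ContinuousMap.const _ v + ε • integralCurveOp F
      (pointwiseBilin TimeInterval (.id ℝ (F →L[ℝ] F))
        (superposition ⟨fderiv ℝ f, hDf⟩ (ψ (ε, x))) (W v)) := by
    have h1 := c.hasFDerivAt (x := x) |>.add (((integralCurveOp F).hasFDerivAt.comp x hSd).const_smul ε)
    have h2 := h1.unique (hWd.congr_of_eventuallyEq
      (by filter_upwards [hUo.mem_nhds hx] with y hy using (hfix y hy).symm))
    exact (congrArg (fun T : F →L[ℝ] C(TimeInterval, F) ↦ T v) h2).symm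
  have h3 := hasDerivAt_of_eq_integralCurveOp hε hWfix hτ
  simp only [hev]
  exact h3

end LocalFlow

/-! ### Invariance of a closed, annihilated 2-form along a flow in a normed space. -/

section FlatInvariance

variable {F : Type*} [NormedAddCommGroup F] [NormedSpace ℝ F]

theorem alternatingMap_two_deriv {Ω : F → F [⋀^Fin 2]→L[ℝ] ℝ} {G : Type*} [NormedAddCommGroup G]
    [NormedSpace ℝ G] {c a b : G → F} {c' a' b' : G →L[ℝ] F} {x : G}
    (hΩ : DifferentiableAt ℝ Ω (c x)) (hc : HasFDerivAt c c' x) (ha : HasFDerivAt a a' x)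
    (hb : HasFDerivAt b b' x) (u : G) :
    DifferentiableAt ℝ (fun y ↦ Ω (c y) ![a y, b y]) x ∧
    fderiv ℝ (fun y ↦ Ω (c y) ![a y, b y]) x u = fderiv ℝ Ω (c x) (c' u) ![a x, b x]
      + Ω (c x) ![a' u, b x] + Ω (c x) ![a x, b' u] := by
  have h1 : HasFDerivAt (fun y ↦ Ω (c y)) ((fderiv ℝ Ω (c x)).comp c') x :=
    hΩ.hasFDerivAt.comp x hc
  have h2 := h1.continuousAlternatingMap_apply (g := fun i y ↦ ![a y, b y] i)
    (g' := fun i ↦ ![a', b'] i) (by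
      intro i
      fin_cases i
      · exact ha
      · exact hb)
  have e : (fun y ↦ Ω (c y) (fun i ↦ ![a y, b y] i)) = fun y ↦ Ω (c y) ![a y, b y] := rfl
  rw [e] at h2
  refine ⟨h2.differentiableAt, ?_⟩
  rw [h2.fderiv, _root_.add_apply, add_assoc]
  congr 1
  rw [Fin.sum_univ_two, _root_.add_apply]
  congr 1
  · change Ω (c x) (Function.update ![a x, b x] 0 (a' u)) = _
    congr 1
    ext i; fin_cases i <;> rfl
  · change Ω (c x) (Function.update ![a x, b x] 1 (b' u)) = _
    congr 1
    ext i; fin_cases i <;> rfl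

/-- The left side is `(L_X Ω)(v, w)` for constant `v`, `w`. Differentiating `i_X Ω = 0` trades
derivatives of `Ω` for derivatives of `X`, and these substitutions turn the three terms of `dΩ(X, v,
w) = 0` into the claim. -/
theorem lie_invariance {Ω : F → F [⋀^Fin 2]→L[ℝ] ℝ} {X : F → F} {y : F}
    (hΩ : DifferentiableAt ℝ Ω y) (hclosed : extDeriv Ω y = 0) (hX : DifferentiableAt ℝ X y)
    (hker : ∀ᶠ z in 𝓝 y, ∀ w, Ω z ![X z, w] = 0) (v w : F) :
    fderiv ℝ Ω y (X y) ![v, w] + Ω y ![fderiv ℝ X y v, w] + Ω y ![v, fderiv ℝ X y w] = 0 := by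
  have hk : ∀ u w : F, fderiv ℝ Ω y u ![X y, w] + Ω y ![fderiv ℝ X y u, w] = 0 := by
    intro u w
    have h1 := (alternatingMap_two_deriv (c := id) (a := X) (b := fun _ ↦ w) (x := y) hΩ
      (hasFDerivAt_id y) hX.hasFDerivAt (hasFDerivAt_const w y) u).2
    have h2 : (fun z ↦ Ω (id z) ![X z, w]) =ᶠ[𝓝 y] fun _ ↦ 0 := by
      filter_upwards [hker] with z hz using hz w
    rw [h2.fderiv_eq] at h1
    have h3 : Ω y ![X y, 0] = 0 := hker.self_of_nhds 0
    simpa [h3] using h1.symm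
  have hd : extDeriv Ω y ![X y, v, w] = 0 := by rw [hclosed]; rfl
  rw [extDeriv_apply hΩ] at hd
  simp only [fderiv_continuousAlternatingMap_apply_const_apply hΩ] at hd
  have e0 : (0 : Fin 3).removeNth ![X y, v, w] = ![v, w] := by ext i; fin_cases i <;> rfl
  have e1 : (1 : Fin 3).removeNth ![X y, v, w] = ![X y, w] := by ext i; fin_cases i <;> rfl
  have e2 : (2 : Fin 3).removeNth ![X y, v, w] = ![X y, v] := by ext i; fin_cases i <;> rfl
  rw [Fin.sum_univ_three, e0, e1, e2] at hd
  have hswap : Ω y ![v, fderiv ℝ X y w] = - Ω y ![fderiv ℝ X y w, v] := by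
    have := (Ω y).toAlternatingMap.map_swap ![fderiv ℝ X y w, v] (show (0 : Fin 2) ≠ 1 by decide)
    refine Eq.trans ?_ this
    change Ω y _ = Ω y _
    congr 1
    ext i; fin_cases i <;> rfl
  have k1 := hk v w
  have k2 := hk w v
  rw [hswap]
  simp at hd
  linarith

/-- A closed `2`-form annihilated by a vector field is preserved by the local flow. -/
theorem flow_pullback_eq {Ω : F → F [⋀^Fin 2]→L[ℝ] ℝ} {X : F → F} {V : Set F} (hV : IsOpen V)
    (hΩ : ∀ y ∈ V, DifferentiableAt ℝ Ω y) (hclosed : ∀ y ∈ V, extDeriv Ω y = 0)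
    (hX : ∀ y ∈ V, DifferentiableAt ℝ X y)
    (hker : ∀ z ∈ V, ∀ w, Ω z ![X z, w] = 0)
    {c a b : ℝ → F} {ε : ℝ} (hcV : ∀ τ ∈ Ioo (-ε) ε, c τ ∈ V)
    (hc : ∀ τ ∈ Ioo (-ε) ε, HasDerivAt c (X (c τ)) τ)
    (ha : ∀ τ ∈ Ioo (-ε) ε, HasDerivAt a (fderiv ℝ X (c τ) (a τ)) τ)
    (hb : ∀ τ ∈ Ioo (-ε) ε, HasDerivAt b (fderiv ℝ X (c τ) (b τ)) τ)
    {τ : ℝ} (hτ : τ ∈ Ioo (-ε) ε) : Ω (c τ) ![a τ, b τ] = Ω (c 0) ![a 0, b 0] := by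
  have h0 : (0 : ℝ) ∈ Ioo (-ε) ε := ⟨by linarith [hτ.1, hτ.2], by linarith [hτ.1, hτ.2]⟩
  -- Since `a` and `b` solve the variational equation along `c`, this derivative is the Lie
  -- derivative expression of `lie_invariance`.
  have hd : ∀ σ ∈ Ioo (-ε) ε, HasDerivAt (fun σ ↦ Ω (c σ) ![a σ, b σ]) 0 σ := by
    intro σ hσ
    have h1 := alternatingMap_two_deriv (hΩ _ (hcV σ hσ)) (hc σ hσ).hasFDerivAt
      (ha σ hσ).hasFDerivAt (hb σ hσ).hasFDerivAt 1
    have h2 := h1.1.hasDerivAt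
    rw [← fderiv_apply_one_eq_deriv, h1.2] at h2
    simp only [ContinuousLinearMap.toSpanSingleton_apply, one_smul] at h2
    rw [lie_invariance (hΩ _ (hcV σ hσ)) (hclosed _ (hcV σ hσ)) (hX _ (hcV σ hσ))
      (by filter_upwards [hV.mem_nhds (hcV σ hσ)] using hker) _ _] at h2
    exact h2
  exact isOpen_Ioo.is_const_of_deriv_eq_zero isPreconnected_Ioo
    (fun σ hσ ↦ (hd σ hσ).differentiableAt.differentiableWithinAt) (fun σ hσ ↦ (hd σ hσ).deriv) hτ h0

end FlatInvariance

/-! ### Pullback and exterior derivative of forms in arbitrary preferred charts. -/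

section ChartForms

theorem two_le_infty : (2 : WithTop ℕ∞) ≤ ∞ :=
  WithTop.coe_le_coe.2 (le_top : (2 : ℕ∞) ≤ ⊤)

variable {E : Type*} [NormedAddCommGroup E] [NormedSpace ℝ E]
  {H : Type*} [TopologicalSpace H] {I : ModelWithCorners ℝ E H}
  {M : Type*} [TopologicalSpace M] [ChartedSpace H M]
  {E' : Type*} [NormedAddCommGroup E'] [NormedSpace ℝ E']
  {H' : Type*} [TopologicalSpace H'] {I' : ModelWithCorners ℝ E' H'}
  {N : Type*} [TopologicalSpace N] [ChartedSpace H' N]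
  {E'' : Type*} [NormedAddCommGroup E''] [NormedSpace ℝ E'']
  {H'' : Type*} [TopologicalSpace H''] {I'' : ModelWithCorners ℝ E'' H''}
  {P : Type*} [TopologicalSpace P] [ChartedSpace H'' P]

theorem DiffForm.pullback_comp {k : ℕ} {f : N → P} {g : M → N} (σ : DiffForm I'' P k) {x : M}
    (hf : MDifferentiableAt I' I'' f (g x)) (hg : MDifferentiableAt I I' g x) :
    DiffForm.pullback (I := I) (f ∘ g) σ x =
      DiffForm.pullback (I := I) g (DiffForm.pullback (I := I') f σ) x := by
  ext v
  change σ (f (g x)) (fun i ↦ mfderiv I I'' (f ∘ g) x (v i)) = _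
  rw [mfderiv_comp x hf hg]
  rfl

theorem DiffForm.pullback_congr {k : ℕ} {f g : M → N} (σ : DiffForm I' N k) {x : M}
    (h : f =ᶠ[𝓝 x] g) :
    DiffForm.pullback (I := I) f σ x = DiffForm.pullback (I := I) g σ x := by
  -- The points `f x` and `g x` are equal only propositionally, so the two values of `σ` live on
  -- different tangent spaces. Passing to the model space `E'` makes the substitution possible.
  have key : ∀ (p q : N) (_ : p = q) (A : E →L[ℝ] E') (v : Fin k → E),
      (σ p : E' [⋀^Fin k]→L[ℝ] ℝ) (fun i ↦ A (v i)) =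
        (σ q : E' [⋀^Fin k]→L[ℝ] ℝ) (fun i ↦ A (v i)) := by
    rintro p _ rfl A v
    rfl
  ext v
  refine (key _ _ h.self_of_nhds (mfderiv I I' f x) v).trans ?_
  have h2 : (mfderiv I I' f x : E →L[ℝ] E') = mfderiv I I' g x := h.mfderiv_eq
  rw [h2]
  rfl

variable [IsManifold I ∞ M]

theorem mdifferentiableAt_extChartAt' {x y : M} (hy : y ∈ (extChartAt I x).source) :
    MDifferentiableAt I 𝓘(ℝ, E) (extChartAt I x) y := by
  have : IsManifold I 1 M := IsManifold.of_le (n := ∞) (by simp)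
  exact mdifferentiableAt_extChartAt (by simpa using hy)

variable [I.Boundaryless]

theorem mdifferentiableAt_extChartAt_symm {x : M} {z : E} (hz : z ∈ (extChartAt I x).target) :
    MDifferentiableAt 𝓘(ℝ, E) I (extChartAt I x).symm z := by
  have : IsManifold I 1 M := IsManifold.of_le (n := ∞) (by simp)
  have := mdifferentiableWithinAt_extChartAt_symm (I := I) hz
  rwa [I.range_eq_univ, mdifferentiableWithinAt_univ] at this

theorem mfderiv_extChartAt_symm_comp {x y : M} (hy : y ∈ (extChartAt I x).source)
    (v : TangentSpace I y) :
    (mfderiv 𝓘(ℝ, E) I (extChartAt I x).symm (extChartAt I x y) : E →L[ℝ] E)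
      (mfderiv I 𝓘(ℝ, E) (extChartAt I x) y v) = v := by
  have : IsManifold I 1 M := IsManifold.of_le (n := ∞) (by simp)
  have h := mfderivWithin_extChartAt_symm_comp_mfderiv_extChartAt' (I := I) hy
  rw [I.range_eq_univ, mfderivWithin_univ] at h
  exact congrArg (fun T : E →L[ℝ] E ↦ T v) h

theorem mfderiv_extChartAt_comp_symm {x : M} {z : E} (hz : z ∈ (extChartAt I x).target) (v : E) :
    (mfderiv I 𝓘(ℝ, E) (extChartAt I x) ((extChartAt I x).symm z) : E →L[ℝ] E)
      (mfderiv 𝓘(ℝ, E) I (extChartAt I x).symm z v) = v := by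
  have : IsManifold I 1 M := IsManifold.of_le (n := ∞) (by simp)
  have h := mfderiv_extChartAt_comp_mfderivWithin_extChartAt_symm (I := I) hz
  rw [I.range_eq_univ, mfderivWithin_univ] at h
  exact congrArg (fun T : E →L[ℝ] E ↦ T v) h

/-- A form is the pullback of its expression in a chart. -/
theorem DiffForm.eq_pullback_inChart {k : ℕ} (σ : DiffForm I M k) {x y : M}
    (hy : y ∈ (extChartAt I x).source) :
    σ y = DiffForm.pullback (I' := 𝓘(ℝ, E)) (extChartAt I x)
      (DiffForm.inChart σ x : DiffForm 𝓘(ℝ, E) E k) y := by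
  have h1 := DiffForm.pullback_comp (I := I) (I' := 𝓘(ℝ, E)) σ (x := y) (g := extChartAt I x)
    (mdifferentiableAt_extChartAt_symm ((extChartAt I x).map_source hy))
    (mdifferentiableAt_extChartAt' hy)
  refine Eq.trans ?_ h1
  have h2 : (extChartAt I x).symm ∘ extChartAt I x =ᶠ[𝓝 y] id := by
    filter_upwards [(isOpen_extChartAt_source x).mem_nhds hy] with w hw
    exact (extChartAt I x).left_inv hw
  rw [DiffForm.pullback_congr σ h2]
  ext v
  change _ = σ y (fun i ↦ mfderiv I I id y (v i))
  rw [mfderiv_id]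
  rfl

/-- The exterior derivative may be computed in any chart of the atlas of preferred charts. -/
theorem DiffForm.extd_eq {k : ℕ} (σ : DiffForm I M k) {x y : M}
    (hy : y ∈ (extChartAt I x).source)
    (hσ : DifferentiableAt ℝ (DiffForm.inChart σ x) (extChartAt I x y)) :
    DiffForm.extd σ y = DiffForm.pullback (I' := 𝓘(ℝ, E)) (extChartAt I x)
      (extDeriv (DiffForm.inChart σ x) : DiffForm 𝓘(ℝ, E) E (k + 1)) y := by
  -- The definition of `extd` at `y` uses the chart at `y`. Naturality of `extDeriv` under this
  -- transition map moves the computation to the chart at `x`.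
  set T : E → E := extChartAt I x ∘ (extChartAt I y).symm with hT
  set z := extChartAt I y y with hz
  have hzy : (extChartAt I y).symm z = y := extChartAt_to_inv y
  have hzt : z ∈ (extChartAt I y).target := mem_extChartAt_target y
  have hTz : T z = extChartAt I x y := by simp only [hT, Function.comp_apply, hzy]
  have hmem : ∀ᶠ w in 𝓝 z, w ∈ (extChartAt I y).target ∧
      (extChartAt I y).symm w ∈ (extChartAt I x).source := by
    refine ((isOpen_extChartAt_target (I := I) y).eventually_mem hzt).and ?_
    refine (continuousAt_extChartAt_symm'' hzt).preimage_mem_nhds ?_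
    rw [hzy]
    exact (isOpen_extChartAt_source x).mem_nhds hy
  have hTsmooth : ContDiffAt ℝ ∞ T z := by
    have := contDiffWithinAt_ext_coord_change (I := I) (n := ∞) x y (y := z)
      ⟨hzt, hmem.self_of_nhds.2⟩
    rwa [I.range_eq_univ, contDiffWithinAt_univ] at this
  have heq : DiffForm.inChart σ y =ᶠ[𝓝 z]
      fun w ↦ (DiffForm.inChart σ x (T w)).compContinuousLinearMap (fderiv ℝ T w) := by
    filter_upwards [hmem.eventually_nhds] with w hw
    have hw0 := hw.self_of_nhds
    have hTw : T w ∈ (extChartAt I x).target := (extChartAt I x).map_source hw0.2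
    have hTd : MDifferentiableAt 𝓘(ℝ, E) 𝓘(ℝ, E) T w :=
      (mdifferentiableAt_extChartAt' hw0.2).comp w (mdifferentiableAt_extChartAt_symm hw0.1)
    have h1 := DiffForm.pullback_comp (I := 𝓘(ℝ, E)) (I' := 𝓘(ℝ, E)) σ (x := w) (g := T)
      (mdifferentiableAt_extChartAt_symm hTw) hTd
    have h2 : (extChartAt I x).symm ∘ T =ᶠ[𝓝 w] (extChartAt I y).symm := by
      filter_upwards [hw] with u hu
      exact (extChartAt I x).left_inv hu.2
    rw [DiffForm.pullback_congr σ h2] at h1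
    refine Eq.trans h1 ?_
    rw [← mfderiv_eq_fderiv]
    rfl
  have h3 := heq.extDeriv_eq
  rw [extDeriv_pullback (by rw [hTz]; exact hσ) hTsmooth (by simpa using two_le_infty)] at h3
  have h4 : (mfderiv I 𝓘(ℝ, E) (extChartAt I x) y : E →L[ℝ] E) =
      (fderiv ℝ T z).comp (mfderiv I 𝓘(ℝ, E) (extChartAt I y) y : E →L[ℝ] E) := by
    have h5 : T ∘ extChartAt I y =ᶠ[𝓝 y] extChartAt I x := by
      filter_upwards [extChartAt_source_mem_nhds (I := I) y] with w hw
      simp only [hT, Function.comp_apply, (extChartAt I y).left_inv hw]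
    have h6 := mfderiv_comp (I := I) (I' := 𝓘(ℝ, E)) (I'' := 𝓘(ℝ, E)) y (g := T)
      (hTsmooth.differentiableAt (by simp)).mdifferentiableAt
      (mdifferentiableAt_extChartAt' (mem_extChartAt_source (I := I) y))
    rw [h5.mfderiv_eq, mfderiv_eq_fderiv] at h6
    exact h6
  ext v
  change (extDeriv (DiffForm.inChart σ y) z) _ = extDeriv (DiffForm.inChart σ x) (extChartAt I x y)
    (fun i ↦ (mfderiv I 𝓘(ℝ, E) (extChartAt I x) y : E →L[ℝ] E) (v i))
  rw [h3, h4, hTz]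
  rfl

/-- The expression in a chart commutes with the exterior derivative. -/
theorem DiffForm.inChart_extd {k : ℕ} (σ : DiffForm I M k) {x : M} {z : E}
    (hz : z ∈ (extChartAt I x).target) (hσ : DifferentiableAt ℝ (DiffForm.inChart σ x) z) :
    DiffForm.inChart (DiffForm.extd σ) x z = extDeriv (DiffForm.inChart σ x) z := by
  have hy : (extChartAt I x).symm z ∈ (extChartAt I x).source := (extChartAt I x).map_target hz
  have hzz : extChartAt I x ((extChartAt I x).symm z) = z := (extChartAt I x).right_inv hz
  have h1 := σ.extd_eq hy (by rwa [hzz])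
  ext v
  change DiffForm.extd σ ((extChartAt I x).symm z)
    (fun i ↦ mfderiv 𝓘(ℝ, E) I (extChartAt I x).symm z (v i)) = _
  rw [h1]
  change extDeriv (DiffForm.inChart σ x) (extChartAt I x ((extChartAt I x).symm z))
    (fun i ↦ (mfderiv I 𝓘(ℝ, E) (extChartAt I x) ((extChartAt I x).symm z) : E →L[ℝ] E)
      (mfderiv 𝓘(ℝ, E) I (extChartAt I x).symm z (v i))) = _
  rw [hzz]
  congr 1
  funext i
  exact mfderiv_extChartAt_comp_symm hz (v i)

end ChartForms

/-! ### Vector fields in charts, and the group law of the maximal flow. -/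

section ManifoldFlow

variable {E : Type*} [NormedAddCommGroup E] [NormedSpace ℝ E]
  {H : Type*} [TopologicalSpace H] {I : ModelWithCorners ℝ E H}
  {M : Type*} [TopologicalSpace M] [ChartedSpace H M]

/-- The expression in the preferred chart at `x` of a differential form is differentiable and
closed, for every `x`. -/
def DiffForm.IsClosedInCharts {k : ℕ} (Ω : DiffForm I M k) : Prop :=
  ∀ x, ∀ z ∈ (extChartAt I x).target,
    DifferentiableAt ℝ (DiffForm.inChart Ω x) z ∧ extDeriv (DiffForm.inChart Ω x) z = 0

/-- The expression of a vector field in the preferred chart at `x`. -/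
def fieldInChart (X : ∀ x : M, TangentSpace I x) (x : M) (z : E) : E :=
  (mfderiv I 𝓘(ℝ, E) (extChartAt I x) ((extChartAt I x).symm z) : E →L[ℝ] E)
    (X ((extChartAt I x).symm z))

variable [IsManifold I ∞ M]

/-- On each fibre, the trivialisation of the tangent bundle at `x` is the derivative of the chart at
`x`. -/
theorem contMDiffAt_vectorField_iff (X : ∀ x : M, TangentSpace I x) {x y : M}
    (hy : y ∈ (extChartAt I x).source) :
    ContMDiffAt I I.tangent ∞ (fun x ↦ (⟨x, X x⟩ : TangentBundle I M)) y ↔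
      ContMDiffAt I 𝓘(ℝ, E) ∞
        (fun y ↦ (mfderiv I 𝓘(ℝ, E) (extChartAt I x) y : E →L[ℝ] E) (X y)) y := by
  have hI : IsManifold I 1 M := IsManifold.of_le (n := ∞) (by simp)
  have hI' : IsManifold I (∞ + 1) M := ‹IsManifold I ∞ M›
  have hy' : y ∈ (trivializationAt E (TangentSpace I) x).baseSet := by simpa using hy
  refine ((trivializationAt E (TangentSpace I) x).contMDiffAt_section_iff (n := ∞) (IB := I)
    (s := X) hy').trans ?_
  have : (fun y ↦ ((trivializationAt E (TangentSpace I) x) ⟨y, X y⟩).2) =ᶠ[𝓝 y]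
      (fun y ↦ (mfderiv I 𝓘(ℝ, E) (extChartAt I x) y : E →L[ℝ] E) (X y)) := by
    filter_upwards [(isOpen_extChartAt_source (I := I) x).mem_nhds hy] with w hw
    have hw' : w ∈ (chartAt H x).source := by simpa using hw
    rw [← TangentBundle.continuousLinearMapAt_trivializationAt hw']
    exact ((trivializationAt E (TangentSpace I) x).continuousLinearMapAt_apply_of_mem ℝ
      (by simpa using hw')  (X w)).symm
  exact this.contMDiffAt_iff

variable [I.Boundaryless]

theorem contDiffAt_fieldInChart {X : ∀ x : M, TangentSpace I x}
    (hX : ContMDiff I I.tangent ∞ (fun x ↦ (⟨x, X x⟩ : TangentBundle I M))) {x : M} {z : E}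
    (hz : z ∈ (extChartAt I x).target) : ContDiffAt ℝ ∞ (fieldInChart X x) z := by
  have h1 := (contMDiffAt_vectorField_iff X ((extChartAt I x).map_target hz)).1 (hX _)
  have h2 : ContMDiffAt 𝓘(ℝ, E) I ∞ (extChartAt I x).symm z := by
    exact (contMDiffOn_extChartAt_symm x).contMDiffAt ((isOpen_extChartAt_target x).mem_nhds hz)
  exact (h1.comp z h2).contDiffAt

theorem hasMFDerivAt_extChartAt_symm_comp {X : ∀ x : M, TangentSpace I x} {x : M} {c : ℝ → E}
    {τ : ℝ} (hτ : c τ ∈ (extChartAt I x).target)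
    (hc : HasDerivAt c (fieldInChart X x (c τ)) τ) :
    HasMFDerivAt 𝓘(ℝ, ℝ) I ((extChartAt I x).symm ∘ c) τ
      ((1 : ℝ →L[ℝ] ℝ).smulRight (X ((extChartAt I x).symm (c τ)))) := by
  have h1 := (mdifferentiableAt_extChartAt_symm hτ).hasMFDerivAt
  have h2 : HasMFDerivAt 𝓘(ℝ, ℝ) 𝓘(ℝ, E) c τ
      ((1 : ℝ →L[ℝ] ℝ).smulRight (M₂ := E) (fieldInChart X x (c τ))) := hc.hasFDerivAt.hasMFDerivAt
  have h3 := h1.comp τ h2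
  refine h3.congr_mfderiv ?_
  ext
  change (mfderiv 𝓘(ℝ, E) I (extChartAt I x).symm (c τ) : E →L[ℝ] E)
    ((1 : ℝ) • fieldInChart X x (c τ)) = (1 : ℝ) • X ((extChartAt I x).symm (c τ))
  rw [one_smul, one_smul]
  have h4 := mfderiv_extChartAt_symm_comp ((extChartAt I x).map_target hτ)
    (X ((extChartAt I x).symm (c τ)))
  rw [(extChartAt I x).right_inv hτ] at h4
  exact h4

variable [T2Space M] {X : ∀ x : M, TangentSpace I x}

/-- The value of `flow` comes from a chosen curve. Uniqueness of integral curves on the overlap of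
the two time intervals, available because `M` is Hausdorff and boundaryless, shows that any other
curve gives the same value. Allowing an arbitrary starting time `τ₁` also covers running the curve
backwards. -/
theorem flow_eq_of_isMIntegralCurveOn [CompleteSpace E]
    (hX : ContMDiff I I.tangent ∞ (fun x ↦ (⟨x, X x⟩ : TangentBundle I M)))
    {γ : ℝ → M} {a b : ℝ}
    (hγ : IsMIntegralCurveOn γ X (Ioo a b)) {τ₁ τ₂ : ℝ} (h₁ : τ₁ ∈ Ioo a b) (h₂ : τ₂ ∈ Ioo a b) :
    γ τ₁ ∈ flowDomain X (τ₂ - τ₁) ∧ flow X (τ₂ - τ₁) (γ τ₁) = γ τ₂ := by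
  have hI : IsManifold I 1 M := IsManifold.of_le (n := ∞) (by simp)
  have hX1 : ContMDiff I I.tangent 1 (fun x ↦ (⟨x, X x⟩ : TangentBundle I M)) :=
    hX.of_le (by simp)
  have hshift : IsMIntegralCurveOn (γ ∘ (· + τ₁)) X (Ioo (a - τ₁) (b - τ₁)) := by
    refine (hγ.comp_add τ₁).mono fun t ht ↦ ?_
    exact ⟨by linarith [ht.1], by linarith [ht.2]⟩
  have hmem : γ τ₁ ∈ flowDomain X (τ₂ - τ₁) :=
    ⟨γ ∘ (· + τ₁), a - τ₁, b - τ₁, ⟨by linarith [h₁.1], by linarith [h₁.2]⟩,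
      ⟨by linarith [h₂.1], by linarith [h₂.2]⟩, by simp, hshift⟩
  refine ⟨hmem, ?_⟩
  rw [flow, dif_pos hmem]
  obtain ⟨c, d, h0, hs, hinit, hcurve⟩ := Classical.choose_spec hmem
  set γ' := Classical.choose hmem
  have huniq := isMIntegralCurveOn_Ioo_eqOn_of_contMDiff_boundaryless (t₀ := 0)
    (a := max c (a - τ₁)) (b := min d (b - τ₁))
    ⟨max_lt h0.1 (by linarith [h₁.1]), lt_min h0.2 (by linarith [h₁.2])⟩ hX1
    (hcurve.mono (Ioo_subset_Ioo (le_max_left _ _) (min_le_left _ _)))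
    (hshift.mono (Ioo_subset_Ioo (le_max_right _ _) (min_le_right _ _)))
    (by simp [hinit])
  have := huniq (show τ₂ - τ₁ ∈ _ from
    ⟨max_lt hs.1 (by linarith [h₂.1]), lt_min hs.2 (by linarith [h₂.2])⟩)
  simpa using this

/-- The curve through `x` and the time-shifted curve through its value at `s` agree at time `s`, so
they glue to one integral curve reaching `s + r`. -/
theorem flow_add [CompleteSpace E]
    (hX : ContMDiff I I.tangent ∞ (fun x ↦ (⟨x, X x⟩ : TangentBundle I M)))
    {s r : ℝ} {x : M} (hs : x ∈ flowDomain X s)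
    (hr : flow X s x ∈ flowDomain X r) :
    x ∈ flowDomain X (s + r) ∧ flow X (s + r) x = flow X r (flow X s x) := by
  have hI : IsManifold I 1 M := IsManifold.of_le (n := ∞) (by simp)
  have hX1 : ContMDiff I I.tangent 1 (fun x ↦ (⟨x, X x⟩ : TangentBundle I M)) :=
    hX.of_le (by simp)
  obtain ⟨γ, a, b, h0, hsab, hγ0, hγ⟩ := hs
  obtain ⟨γ', c, d, h0', hrcd, hγ0', hγ'⟩ := hr
  have e1 : flow X s x = γ s := by
    have := (flow_eq_of_isMIntegralCurveOn hX hγ h0 hsab).2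
    rwa [sub_zero, hγ0] at this
  have e2 : flow X r (γ' 0) = γ' r := by
    have := (flow_eq_of_isMIntegralCurveOn hX hγ' h0' hrcd).2
    rwa [sub_zero] at this
  have hshift : IsMIntegralCurveOn (γ' ∘ (· + -s)) X (Ioo (c + s) (d + s)) := by
    refine (hγ'.comp_add (-s)).mono fun t ht ↦ ?_
    exact ⟨by linarith [ht.1], by linarith [ht.2]⟩
  have hsh : s ∈ Ioo a b ∩ Ioo (c + s) (d + s) :=
    ⟨hsab, by linarith [h0'.1], by linarith [h0'.2]⟩
  have hagree : γ s = (γ' ∘ (· + -s)) s := by simp [hγ0', e1]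
  have hglue := isMIntegralCurveOn_piecewise hX1 hγ hshift hsh hagree
  have heq := eqOn_piecewise_of_isMIntegralCurveOn_Ioo hX1 hγ hshift hsh hagree
  rw [Ioo_union_Ioo' (hsh.2.1.trans hsh.1.2) (hsh.1.1.trans hsh.2.2)] at hglue
  have hend : s + r ∈ Ioo (c + s) (d + s) := ⟨by linarith [hrcd.1], by linarith [hrcd.2]⟩
  have key := flow_eq_of_isMIntegralCurveOn hX hglue (τ₁ := 0) (τ₂ := s + r)
    ⟨min_lt_of_left_lt h0.1, lt_max_of_lt_left h0.2⟩
    ⟨min_lt_of_right_lt hend.1, lt_max_of_lt_right hend.2⟩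
  rw [heq hend, piecewise_eq_of_mem _ _ _ h0, hγ0, sub_zero] at key
  refine ⟨key.1, key.2.trans ?_⟩
  rw [← hγ0', e2]
  simp

theorem flow_neg [CompleteSpace E]
    (hX : ContMDiff I I.tangent ∞ (fun x ↦ (⟨x, X x⟩ : TangentBundle I M)))
    {s : ℝ} {x : M} (hs : x ∈ flowDomain X s) :
    flow X s x ∈ flowDomain X (-s) ∧ flow X (-s) (flow X s x) = x := by
  obtain ⟨γ, a, b, h0, hsab, hγ0, hγ⟩ := hs
  have e1 := (flow_eq_of_isMIntegralCurveOn hX hγ h0 hsab).2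
  rw [sub_zero, hγ0] at e1
  have e2 := flow_eq_of_isMIntegralCurveOn hX hγ hsab h0
  rw [zero_sub, hγ0] at e2
  rwa [e1]

end ManifoldFlow

/-! ### Open domain, smoothness and form invariance of the maximal flow. -/

section FlowRegularity

/-- A function that is smooth near `z` agrees near `z` with a globally smooth function. -/
theorem exists_contDiff_eqOn {E : Type*} [NormedAddCommGroup E] [NormedSpace ℝ E]
    [FiniteDimensional ℝ E] {f : E → E} {U : Set E} (hU : IsOpen U)
    (hf : ∀ z ∈ U, ContDiffAt ℝ ∞ f z) {z : E} (hz : z ∈ U) :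
    ∃ (g : E → E) (V : Set E), ContDiff ℝ ∞ g ∧ IsOpen V ∧ z ∈ V ∧ V ⊆ U ∧ EqOn g f V := by
  obtain ⟨R, hR, hball⟩ := Metric.nhds_basis_closedBall.mem_iff.1 (hU.mem_nhds hz)
  let χ : ContDiffBump z := ⟨R / 2, R, by positivity, by linarith⟩
  refine ⟨fun w ↦ χ w • f w, Metric.ball z (R / 2), ?_, Metric.isOpen_ball,
    Metric.mem_ball_self (by positivity), ?_, ?_⟩
  · rw [contDiff_iff_contDiffAt]
    intro w
    by_cases hw : w ∈ U
    · exact χ.contDiffAt.smul (hf w hw)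
    · have hw' : w ∉ tsupport χ := by
        rw [χ.tsupport_eq]
        exact fun h ↦ hw (hball h)
      have h0 : (fun w ↦ χ w • f w) =ᶠ[𝓝 w] fun _ ↦ 0 := by
        filter_upwards [notMem_tsupport_iff_eventuallyEq.1 hw'] with u hu
        simp [hu]
      exact contDiffAt_const.congr_of_eventuallyEq h0
  · exact (Metric.ball_subset_closedBall.trans
      (Metric.closedBall_subset_closedBall (by linarith))).trans hball
  · intro w hw
    have : χ w = 1 := χ.one_of_mem_closedBall (Metric.ball_subset_closedBall hw)
    simp [this]

variable {E : Type*} [NormedAddCommGroup E] [NormedSpace ℝ E] [FiniteDimensional ℝ E]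
  {H : Type*} [TopologicalSpace H] {I : ModelWithCorners ℝ E H} [I.Boundaryless]
  {M : Type*} [TopologicalSpace M] [ChartedSpace H M] [IsManifold I ∞ M] [T2Space M]
  {X : ∀ x : M, TangentSpace I x}

/-- At `y`, the time-`s` map of the flow of `X` is defined and smooth, and preserves `Ω`. -/
def FlowPreservesAt (X : ∀ x : M, TangentSpace I x) (Ω : DiffForm I M 2) (s : ℝ) (y : M) : Prop :=
  y ∈ flowDomain X s ∧ ContMDiffAt I I ∞ (flow X s) y ∧
    DiffForm.pullback (I := I) (flow X s) Ω y = Ω y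

/-- The field in the chart at `x` is replaced by a global smooth field equal to it near the image of
`x`. The local flow stays in the region of agreement, so uniqueness identifies its conjugate by the
chart with `flow X`, and the flat invariance theorem applies. -/
theorem exists_local_flowPreservesAt
    (hX : ContMDiff I I.tangent ∞ (fun x ↦ (⟨x, X x⟩ : TangentBundle I M)))
    {Ω : DiffForm I M 2} (hΩ : Ω.IsClosedInCharts)
    (hker : ∀ (y : M) (w : TangentSpace I y), Ω y ![X y, w] = 0) (x : M) :
    ∃ ε > 0, ∃ W : Set M, IsOpen W ∧ x ∈ W ∧ ∀ σ ∈ Ioo (-ε) ε, ∀ y ∈ W,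
      FlowPreservesAt X Ω σ y := by
  have : CompleteSpace E := FiniteDimensional.complete ℝ E
  set φ := extChartAt I x with hφ
  have hx : x ∈ φ.source := mem_extChartAt_source x
  obtain ⟨f, V, hf, hV, hxV, hVt, hfV⟩ := exists_contDiff_eqOn (f := fieldInChart X x)
    (isOpen_extChartAt_target x) (fun z hz ↦ contDiffAt_fieldInChart hX hz)
    (φ.map_source hx)
  obtain ⟨ε, hε, U, hU, hxU, Φ, hΦ⟩ := exists_smooth_local_flow hf (φ x) (hV.mem_nhds hxV)
  have h0 : (0 : ℝ) ∈ Ioo (-ε) ε := by simp [hε]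
  refine ⟨ε, hε, φ.source ∩ φ ⁻¹' U,
    (continuousOn_extChartAt x).isOpen_inter_preimage (isOpen_extChartAt_source x) hU,
    ⟨hx, hxU⟩, ?_⟩
  have hW : IsOpen (φ.source ∩ φ ⁻¹' U) :=
    (continuousOn_extChartAt x).isOpen_inter_preimage (isOpen_extChartAt_source x) hU
  have hflow : ∀ σ ∈ Ioo (-ε) ε, ∀ y ∈ φ.source ∩ φ ⁻¹' U,
      y ∈ flowDomain X σ ∧ flow X σ y = φ.symm (Φ σ (φ y)) := by
    intro σ hσ y hy
    have hcurve : IsMIntegralCurveOn (φ.symm ∘ fun τ ↦ Φ τ (φ y)) X (Ioo (-ε) ε) := by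
      intro τ hτ
      have h1 := (hΦ _ hy.2).2 τ hτ
      refine (hasMFDerivAt_extChartAt_symm_comp (hVt h1.1) ?_).hasMFDerivWithinAt
      rw [← hfV h1.1]
      exact h1.2.2.1
    have h2 := flow_eq_of_isMIntegralCurveOn hX hcurve h0 hσ
    simp only [Function.comp_apply, (hΦ _ hy.2).1, φ.left_inv hy.1, sub_zero] at h2
    exact h2
  intro σ hσ y hy
  have heq : flow X σ =ᶠ[𝓝 y] φ.symm ∘ Φ σ ∘ φ := by
    filter_upwards [hW.mem_nhds hy] with w hw using (hflow σ hσ w hw).2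
  have hφs : ContMDiffAt I 𝓘(ℝ, E) ∞ φ y :=
    (contMDiffOn_extChartAt (I := I) (x := x)).contMDiffAt
      ((chartAt H x).open_source.mem_nhds (by simpa [hφ] using hy.1))
  have hΦσ := (hΦ _ hy.2).2 σ hσ
  have hΦs : ContMDiffAt 𝓘(ℝ, E) 𝓘(ℝ, E) ∞ (Φ σ) (φ y) := hΦσ.2.1.contMDiffAt
  have hsymm : ContMDiffAt 𝓘(ℝ, E) I ∞ φ.symm (Φ σ (φ y)) :=
    (contMDiffOn_extChartAt_symm x).contMDiffAt
      ((isOpen_extChartAt_target x).mem_nhds (hVt hΦσ.1))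
  refine ⟨(hflow σ hσ y hy).1, ?_, ?_⟩
  · exact (hsymm.comp y (hΦs.comp y hφs)).congr_of_eventuallyEq heq
  rw [DiffForm.pullback_congr Ω heq]
  have hd : MDifferentiableAt I 𝓘(ℝ, E) (Φ σ ∘ φ) y :=
    (hΦs.comp y hφs).mdifferentiableAt (by simp)
  have h1 := DiffForm.pullback_comp (I := I) (I' := 𝓘(ℝ, E)) Ω (x := y) (g := Φ σ ∘ φ)
    (hsymm.mdifferentiableAt (by simp)) hd
  have h2 := DiffForm.pullback_comp (I := I) (I' := 𝓘(ℝ, E)) (I'' := 𝓘(ℝ, E))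
    (DiffForm.inChart Ω x : DiffForm 𝓘(ℝ, E) E 2) (x := y) (f := Φ σ) (g := φ)
    (hΦs.mdifferentiableAt (by simp)) (hφs.mdifferentiableAt (by simp))
  refine h1.trans (h2.trans ?_)
  rw [Ω.eq_pullback_inChart hy.1]
  have h3 : DiffForm.pullback (I := 𝓘(ℝ, E)) (I' := 𝓘(ℝ, E)) (Φ σ)
      (DiffForm.inChart Ω x : DiffForm 𝓘(ℝ, E) E 2) (φ y) = DiffForm.inChart Ω x (φ y) := by
    ext v
    have hinv := flow_pullback_eq (Ω := DiffForm.inChart Ω x) (X := f) hV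
      (fun z hz ↦ (hΩ x z (hVt hz)).1) (fun z hz ↦ (hΩ x z (hVt hz)).2)
      (fun z _ ↦ hf.differentiable (by simp) z) (fun z hz w ↦ ?_)
      (c := fun τ ↦ Φ τ (φ y)) (a := fun τ ↦ fderiv ℝ (Φ τ) (φ y) (v 0))
      (b := fun τ ↦ fderiv ℝ (Φ τ) (φ y) (v 1)) (ε := ε)
      (fun τ hτ ↦ ((hΦ _ hy.2).2 τ hτ).1) (fun τ hτ ↦ ((hΦ _ hy.2).2 τ hτ).2.2.1)
      (fun τ hτ ↦ ((hΦ _ hy.2).2 τ hτ).2.2.2 _) (fun τ hτ ↦ ((hΦ _ hy.2).2 τ hτ).2.2.2 _) hσ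
    · have hid : fderiv ℝ (Φ 0) (φ y) = ContinuousLinearMap.id ℝ E := by
        have : Φ 0 =ᶠ[𝓝 (φ y)] id := by
          filter_upwards [hU.mem_nhds hy.2] with z hz using (hΦ z hz).1
        rw [this.fderiv_eq, fderiv_id]
      simp only [hid, (hΦ _ hy.2).1] at hinv
      have ev : v = ![v 0, v 1] := by ext i; fin_cases i <;> rfl
      change DiffForm.inChart Ω x (Φ σ (φ y)) (fun i ↦ mfderiv 𝓘(ℝ, E) 𝓘(ℝ, E) (Φ σ) (φ y) (v i)) =
        DiffForm.inChart Ω x (φ y) v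
      rw [mfderiv_eq_fderiv]
      refine Eq.trans ?_ (hinv.trans
        (congrArg (DiffForm.inChart Ω x (φ y)) ev.symm))
      congr 1
      ext i
      fin_cases i <;> rfl
    · rw [hfV hz]
      have := hker (φ.symm z) (mfderiv 𝓘(ℝ, E) I φ.symm z w)
      refine Eq.trans ?_ this
      change Ω (φ.symm z) (fun i ↦ mfderiv 𝓘(ℝ, E) I φ.symm z (![fieldInChart X x z, w] i)) = _
      congr 1
      ext i
      fin_cases i
      · have h4 := mfderiv_extChartAt_symm_comp (I := I) (x := x) (φ.map_target (hVt hz))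
          (X (φ.symm z))
        rw [← hφ, φ.right_inv (hVt hz)] at h4
        exact h4
      · rfl
  ext v
  exact congrArg (fun T : E [⋀^Fin 2]→L[ℝ] ℝ ↦
    T (fun i ↦ (mfderiv I 𝓘(ℝ, E) φ y : E →L[ℝ] E) (v i))) h3

/-- Neighbourhoods are needed because smoothness and the pullback depend on the germ of `flow X (s +
r)`, hence on the group law at nearby points too. -/
theorem FlowPreservesAt.add
    (hX : ContMDiff I I.tangent ∞ (fun x ↦ (⟨x, X x⟩ : TangentBundle I M)))
    {Ω : DiffForm I M 2} {s r : ℝ} {y : M} (hs : ∀ᶠ z in 𝓝 y, FlowPreservesAt X Ω s z)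
    (hr : ∀ᶠ z in 𝓝 (flow X s y), FlowPreservesAt X Ω r z) :
    ∀ᶠ z in 𝓝 y, FlowPreservesAt X Ω (s + r) z := by
  have : CompleteSpace E := FiniteDimensional.complete ℝ E
  have hr' : ∀ᶠ z in 𝓝 y, FlowPreservesAt X Ω r (flow X s z) :=
    hs.self_of_nhds.2.1.continuousAt.eventually hr
  filter_upwards [(hs.and hr').eventually_nhds] with z hz
  obtain ⟨h1, h2⟩ := hz.self_of_nhds
  have heq : flow X (s + r) =ᶠ[𝓝 z] flow X r ∘ flow X s := by
    filter_upwards [hz] with w hw using (flow_add hX hw.1.1 hw.2.1).2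
  refine ⟨(flow_add hX h1.1 h2.1).1, (h2.2.1.comp z h1.2.1).congr_of_eventuallyEq heq, ?_⟩
  rw [DiffForm.pullback_congr Ω heq, DiffForm.pullback_comp (I := I) (I' := I) Ω
    (h2.2.1.mdifferentiableAt (by simp)) (h1.2.1.mdifferentiableAt (by simp))]
  rw [← h1.2.2]
  ext v
  exact congrArg (fun T : E [⋀^Fin 2]→L[ℝ] ℝ ↦
    T (fun i ↦ (mfderiv I I (flow X s) z : E →L[ℝ] E) (v i))) h2.2.2

/-- The maximal flow of a smooth vector field annihilating a closed `2`-form has open domain, is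
smooth and preserves this form. -/
theorem eventually_flowPreservesAt
    (hX : ContMDiff I I.tangent ∞ (fun x ↦ (⟨x, X x⟩ : TangentBundle I M)))
    {Ω : DiffForm I M 2} (hΩ : Ω.IsClosedInCharts)
    (hker : ∀ (y : M) (w : TangentSpace I y), Ω y ![X y, w] = 0) {s : ℝ} {x : M}
    (hx : x ∈ flowDomain X s) : ∀ᶠ y in 𝓝 x, FlowPreservesAt X Ω s y := by
  have : CompleteSpace E := FiniteDimensional.complete ℝ E
  obtain ⟨γ, a, b, h0, hs, hγ0, hγ⟩ := hx
  let P : ℝ → Prop := fun τ ↦ ∀ᶠ y in 𝓝 x, FlowPreservesAt X Ω τ y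
  have hP0 : P 0 := by
    obtain ⟨ε, hε, W, hW, hxW, h⟩ := exists_local_flowPreservesAt hX hΩ hker x
    filter_upwards [hW.mem_nhds hxW] with y hy using h 0 (by simp [hε]) y hy
  -- Along the curve from time `0` to `s`, validity near `x` need only pass between sufficiently
  -- close times, in both directions, since the interval is connected.
  refine isPreconnected_Ioo.induction₂' (fun τ₁ τ₂ ↦ P τ₁ → P τ₂) ?_
    (fun _ _ _ _ _ _ h h' ↦ h' ∘ h) h0 hs hP0
  intro τ hτ
  obtain ⟨ε, hε, W, hW, hτW, h⟩ := exists_local_flowPreservesAt hX hΩ hker (γ τ)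
  have hstep : ∀ τ₁ ∈ Ioo a b, ∀ τ₂ ∈ Ioo a b, γ τ₁ ∈ W → τ₂ - τ₁ ∈ Ioo (-ε) ε →
      P τ₁ → P τ₂ := by
    intro τ₁ h₁ τ₂ h₂ hW₁ hε₁ hP₁
    have e1 := (flow_eq_of_isMIntegralCurveOn hX hγ h0 h₁).2
    rw [sub_zero, hγ0] at e1
    have := FlowPreservesAt.add hX (r := τ₂ - τ₁) hP₁ (by
      rw [e1]
      filter_upwards [hW.mem_nhds hW₁] with y hy using h _ hε₁ y hy)
    rwa [add_sub_cancel] at this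
  filter_upwards [self_mem_nhdsWithin, (hγ τ hτ).1.preimage_mem_nhdsWithin (hW.mem_nhds hτW),
    mem_nhdsWithin_of_mem_nhds (Ioo_mem_nhds (show τ - ε < τ by linarith)
      (show τ < τ + ε by linarith))] with σ hσ hσW hσε
  exact ⟨hstep τ hτ σ hσ hτW ⟨by linarith [hσε.1], by linarith [hσε.2]⟩,
    hstep σ hσ τ hτ hσW ⟨by linarith [hσε.2], by linarith [hσε.1]⟩⟩

end FlowRegularity

/-- Chart expressions commute with `d`, so this is `d ∘ d = 0` in the model space. -/
theorem DiffForm.isClosedInCharts_neg_extd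
    {E : Type*} [NormedAddCommGroup E] [NormedSpace ℝ E]
    {H : Type*} [TopologicalSpace H] {I : ModelWithCorners ℝ E H} [I.Boundaryless]
    {M : Type*} [TopologicalSpace M] [ChartedSpace H M] [IsManifold I ∞ M]
    {k : ℕ} {σ : DiffForm I M k}
    (hσ : ∀ x, ∀ z ∈ (extChartAt I x).target, ContDiffAt ℝ ∞ (DiffForm.inChart σ x) z) :
    DiffForm.IsClosedInCharts (fun y ↦ -DiffForm.extd σ y : DiffForm I M (k + 1)) := by
  intro x z hz
  have heq : DiffForm.inChart (fun y ↦ -DiffForm.extd σ y : DiffForm I M (k + 1)) x =ᶠ[𝓝 z]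
      (-1 : ℝ) • extDeriv (DiffForm.inChart σ x) := by
    filter_upwards [(isOpen_extChartAt_target x).mem_nhds hz] with w hw
    have h1 := DiffForm.inChart_extd σ hw ((hσ x w hw).differentiableAt (by simp))
    rw [Pi.smul_apply, neg_one_smul, ← h1]
    rfl
  have hd : DifferentiableAt ℝ (extDeriv (DiffForm.inChart σ x)) z := by
    have h2 : DifferentiableAt ℝ (fderiv ℝ (DiffForm.inChart σ x)) z :=
      ((hσ x z hz).fderiv_right (m := 1) (by exact_mod_cast two_le_infty)).differentiableAt
        (by simp)
    exact (ContinuousAlternatingMap.alternatizeUncurryFinCLM ℝ E ℝ).differentiableAt.comp z h2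
  refine ⟨(hd.const_smul (-1 : ℝ)).congr_of_eventuallyEq heq, ?_⟩
  rw [heq.extDeriv_eq, extDeriv_smul,
    extDeriv_extDeriv_apply (hσ x z hz) (by simpa using two_le_infty), smul_zero]

/-! ### Canonical coordinates on the cotangent bundle. -/

section Cotangent

variable {E : Type*} [NormedAddCommGroup E] [NormedSpace ℝ E]
  {Q : Type*} [TopologicalSpace Q] [ChartedSpace E Q] [IsManifold 𝓘(ℝ, E) ∞ Q]

/-- Needed for uniqueness of integral curves. Covectors over one point are separated in a common
trivialisation, those over distinct points by their projections. -/
instance [T2Space Q] : T2Space (CotangentBundle E Q) where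
  t2 := by
    intro α β h
    have hproj : Continuous (Bundle.TotalSpace.proj : CotangentBundle E Q → Q) :=
      FiberBundle.continuous_proj _ _
    by_cases hp : α.proj = β.proj
    · let e := trivializationAt (E →L[ℝ] ℝ)
        (fun x : Q ↦ TangentSpace 𝓘(ℝ, E) x →L[ℝ] Bundle.Trivial Q ℝ x) α.proj
      have hα : α ∈ e.source := FiberBundle.mem_trivializationAt_proj_source
      have hβ : β ∈ e.source := by
        rw [e.mem_source, ← hp, ← e.mem_source]
        exact hα
      obtain ⟨u, v, hu, hv, hau, hbv, huv⟩ := t2_separation (e.injOn.ne hα hβ h)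
      exact ⟨e.source ∩ e ⁻¹' u, e.source ∩ e ⁻¹' v, e.isOpen_inter_preimage hu,
        e.isOpen_inter_preimage hv, ⟨hα, hau⟩, ⟨hβ, hbv⟩,
        (huv.preimage e).mono inter_subset_right inter_subset_right⟩
    · obtain ⟨u, v, hu, hv, hau, hbv, huv⟩ := t2_separation hp
      exact ⟨_, _, hu.preimage hproj, hv.preimage hproj, hau, hbv, huv.preimage _⟩

theorem cotangent_extChartAt_apply (α₀ β : CotangentBundle E Q) :
    extChartAt (modelTsQ E) α₀ β = (extChartAt 𝓘(ℝ, E) α₀.proj β.proj,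
      ContinuousLinearMap.inCoordinates E (TangentSpace 𝓘(ℝ, E)) ℝ (Bundle.Trivial Q ℝ)
        α₀.proj β.proj α₀.proj β.proj β.snd) := by
  rw [FiberBundle.extChartAt]
  rfl

theorem cotangent_proj_mem_source {α₀ β : CotangentBundle E Q}
    (hβ : β ∈ (extChartAt (modelTsQ E) α₀).source) : β.proj ∈ (chartAt E α₀.proj).source := by
  rw [extChartAt_source, FiberBundle.chartedSpace_chartAt] at hβ
  simpa using hβ.1

/-- The second chart component is the momentum `p`: the covector read through the inverse of the
base chart. -/
theorem cotangent_extChartAt_snd_apply {α₀ β : CotangentBundle E Q}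
    (hβ : β.proj ∈ (chartAt E α₀.proj).source) (a : E) :
    (extChartAt (modelTsQ E) α₀ β).2 a =
      β.snd (mfderiv 𝓘(ℝ, E) 𝓘(ℝ, E) (extChartAt 𝓘(ℝ, E) α₀.proj).symm
        (extChartAt 𝓘(ℝ, E) α₀.proj β.proj) a) := by
  have : IsManifold 𝓘(ℝ, E) 1 Q := IsManifold.of_le (n := ∞) (by simp)
  have h := TangentBundle.symmL_trivializationAt (I := 𝓘(ℝ, E)) hβ
  rw [ModelWithCorners.range_eq_univ, mfderivWithin_univ] at h
  rw [cotangent_extChartAt_apply, ← h]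
  simp [ContinuousLinearMap.inCoordinates]
  rfl

/-- This is `θ_Q = p dx`: in the chart the bundle projection is `(x, p) ↦ x`, and the fibre
coordinate is `p`. -/
theorem liouvilleForm_inChart (α₀ : CotangentBundle E Q) {z : E × (E →L[ℝ] ℝ)}
    (hz : z ∈ (extChartAt (modelTsQ E) α₀).target) (v : Fin 1 → E × (E →L[ℝ] ℝ)) :
    DiffForm.inChart (liouvilleForm E Q) α₀ z v = z.2 (v 0).1 := by
  have hIQ : IsManifold 𝓘(ℝ, E) 1 Q := IsManifold.of_le (n := ∞) (by simp)
  set φ := extChartAt (modelTsQ E) α₀ with hφ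
  set ψ := extChartAt 𝓘(ℝ, E) α₀.proj with hψ
  have hcoord : ∀ w ∈ φ.target, (φ.symm w).proj ∈ (chartAt E α₀.proj).source ∧
      ψ (φ.symm w).proj = w.1 := by
    intro w hw
    have h1 := φ.right_inv hw
    rw [hφ, cotangent_extChartAt_apply] at h1
    have h2 : φ.symm w ∈ φ.source := φ.map_target hw
    exact ⟨cotangent_proj_mem_source h2, congrArg Prod.fst h1⟩
  have hψt : z.1 ∈ ψ.target := by
    rw [← (hcoord z hz).2]
    exact ψ.map_source (by simpa [hψ] using (hcoord z hz).1)
  have hz2 := cotangent_extChartAt_snd_apply (hcoord z hz).1 (v 0).1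
  rw [← hφ, φ.right_inv hz, ← hψ, (hcoord z hz).2] at hz2
  rw [hz2]
  have hproj : MDifferentiableAt (modelTsQ E) 𝓘(ℝ, E)
      (fun β : CotangentBundle E Q ↦ β.proj) (φ.symm z) :=
    (Bundle.contMDiff_proj _ (n := 1)).mdifferentiableAt (by simp)
  have hsymm := mdifferentiableAt_extChartAt_symm (I := modelTsQ E) hz
  have h3 := mfderiv_comp z hproj hsymm
  have h4 : (fun β : CotangentBundle E Q ↦ β.proj) ∘ φ.symm =ᶠ[𝓝 z] ψ.symm ∘ Prod.fst := by
    filter_upwards [(isOpen_extChartAt_target α₀).mem_nhds hz] with w hw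
    have h5 := hcoord w hw
    simp only [Function.comp_apply, ← h5.2]
    exact (ψ.left_inv (by simpa [hψ] using h5.1)).symm
  have h6 : MDifferentiableAt 𝓘(ℝ, E) 𝓘(ℝ, E) ψ.symm z.1 := mdifferentiableAt_extChartAt_symm hψt
  have h7 := mfderiv_comp (I := 𝓘(ℝ, E × (E →L[ℝ] ℝ))) (I' := 𝓘(ℝ, E)) z (g := ψ.symm)
    (f := Prod.fst) h6 differentiableAt_fst.mdifferentiableAt
  rw [h4.mfderiv_eq, h7, mfderiv_eq_fderiv, fderiv_fst] at h3
  change (φ.symm z).snd ((mfderiv (modelTsQ E) 𝓘(ℝ, E)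
    (fun β : CotangentBundle E Q ↦ β.proj) (φ.symm z))
      (mfderiv 𝓘(ℝ, E × (E →L[ℝ] ℝ)) (modelTsQ E) φ.symm z (v 0))) = _
  have h8 := congrArg (fun T : (E × (E →L[ℝ] ℝ)) →L[ℝ] E ↦ T (v 0)) h3
  exact congrArg (φ.symm z).snd h8.symm

end Cotangent

/-! ### Hamilton's equations as linear algebra; `∂H/∂p` lies in the double dual of `E` and must be
brought back to `E`. -/

section Reflexive

variable (E : Type*) [NormedAddCommGroup E] [NormedSpace ℝ E] [FiniteDimensional ℝ E]

/-- A finite-dimensional space is isomorphic to its double dual. -/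
theorem exists_doubleDual_inverse :
    ∃ J : ((E →L[ℝ] ℝ) →L[ℝ] ℝ) →L[ℝ] E, ∀ (l : (E →L[ℝ] ℝ) →L[ℝ] ℝ) (b : E →L[ℝ] ℝ),
      b (J l) = l b := by
  have hdual : ∀ (V : Type _) [NormedAddCommGroup V] [NormedSpace ℝ V] [FiniteDimensional ℝ V],
      Module.finrank ℝ (V →L[ℝ] ℝ) = Module.finrank ℝ V := fun V _ _ _ ↦ by
    rw [← (LinearMap.toContinuousLinearMap : (V →ₗ[ℝ] ℝ) ≃ₗ[ℝ] V →L[ℝ] ℝ).finrank_eq]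
    exact Subspace.dual_finrank_eq
  let e : E ≃L[ℝ] ((E →L[ℝ] ℝ) →L[ℝ] ℝ) :=
    (LinearEquiv.ofInjectiveOfFinrankEq
      (NormedSpace.inclusionInDoubleDualLi ℝ (E := E)).toLinearMap
      (NormedSpace.inclusionInDoubleDualLi ℝ (E := E)).injective
      (by rw [hdual, hdual])).toContinuousLinearEquiv
  refine ⟨e.symm, fun l b ↦ ?_⟩
  have h : e (e.symm l) b = l b := by rw [e.apply_symm_apply]
  exact h

/-- The inverse of the evaluation map into the double dual. -/
def doubleDualInverse : ((E →L[ℝ] ℝ) →L[ℝ] ℝ) →L[ℝ] E := (exists_doubleDual_inverse E).choose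

theorem apply_doubleDualInverse (l : (E →L[ℝ] ℝ) →L[ℝ] ℝ) (b : E →L[ℝ] ℝ) :
    b (doubleDualInverse E l) = l b := (exists_doubleDual_inverse E).choose_spec l b

variable {E}

/-- The components of the evolution vector field of a Hamiltonian with differential `D`, in
canonical coordinates. -/
def hamiltonVector (D : ((E × (E →L[ℝ] ℝ)) × ℝ) →L[ℝ] ℝ) : (E × (E →L[ℝ] ℝ)) × ℝ :=
  ((doubleDualInverse E (D ∘L .inl ℝ _ ℝ ∘L .inr ℝ E (E →L[ℝ] ℝ)),
    -(D ∘L .inl ℝ _ ℝ ∘L .inl ℝ E (E →L[ℝ] ℝ))), 1)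

set_option synthInstance.maxHeartbeats 200000 in
theorem contDiff_hamiltonVector :
    ContDiff ℝ ∞ (hamiltonVector : (((E × (E →L[ℝ] ℝ)) × ℝ) →L[ℝ] ℝ) → _) := by
  unfold hamiltonVector
  fun_prop

/-- The bracketed expression is `dx ∧ dp + dH ∧ dt` evaluated on `a` and `b`. Momentum directions
`b` force `a_x = ∂H/∂p` and position directions force `a_p = -∂H/∂x`; the time direction then holds
automatically, as the `x` and `p` terms of `D a` cancel. -/
theorem eq_hamiltonVector_iff (D : ((E × (E →L[ℝ] ℝ)) × ℝ) →L[ℝ] ℝ)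
    (a : (E × (E →L[ℝ] ℝ)) × ℝ) :
    ((∀ b : (E × (E →L[ℝ] ℝ)) × ℝ,
      -((a.1.2 b.1.1 - D a * b.2) - (b.1.2 a.1.1 - D b * a.2)) = 0) ∧ a.2 = 1) ↔
      a = hamiltonVector D := by
  have hD : ∀ b, D b = D ((b.1.1, 0), 0) + D ((0, b.1.2), 0) + b.2 * D ((0, 0), 1) := by
    intro b
    rw [← smul_eq_mul, ← map_smul, ← map_add, ← map_add]
    congr 1
    ext <;> simp
  constructor
  · rintro ⟨h, h2⟩
    have e1 : a.1.1 = (hamiltonVector D).1.1 := by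
      apply (NormedSpace.inclusionInDoubleDualLi ℝ (E := E)).injective
      ext b
      change b a.1.1 = b _
      rw [hamiltonVector, apply_doubleDualInverse]
      have := h ((0, b), 0)
      simp [h2] at this
      simp
      linarith
    have e2 : a.1.2 = (hamiltonVector D).1.2 := by
      ext b
      have := h ((b, 0), 0)
      simp [h2] at this
      simp [hamiltonVector]
      linarith
    exact Prod.ext (Prod.ext e1 e2) h2
  · rintro rfl
    refine ⟨fun b ↦ ?_, rfl⟩
    rw [hD (hamiltonVector D), hD b]
    have h1 : D ((0, b.1.2), 0) = b.1.2 (hamiltonVector D).1.1 := by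
      rw [hamiltonVector, apply_doubleDualInverse]
      simp
    have h1' : D ((0, (hamiltonVector D).1.2), 0) =
        (hamiltonVector D).1.2 (hamiltonVector D).1.1 := by
      rw [hamiltonVector, apply_doubleDualInverse]
      simp
    have h2 : ∀ u, (hamiltonVector D).1.2 u = - D ((u, 0), 0) := by
      intro u
      simp [hamiltonVector]
    have h3 : (hamiltonVector D).2 = 1 := rfl
    rw [h1, h1', h2, h2, h3]
    ring

end Reflexive

theorem extDeriv_one_apply {F : Type*} [NormedAddCommGroup F] [NormedSpace ℝ F]
    {σ : F → F [⋀^Fin 1]→L[ℝ] ℝ} {z : F} (hσ : DifferentiableAt ℝ σ z) (u v : F) :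
    extDeriv σ z ![u, v] =
      fderiv ℝ (fun z ↦ σ z ![v]) z u - fderiv ℝ (fun z ↦ σ z ![u]) z v := by
  have e0 : (0 : Fin 2).removeNth ![u, v] = ![v] := by ext i; fin_cases i; rfl
  have e1 : (1 : Fin 2).removeNth ![u, v] = ![u] := by ext i; fin_cases i; rfl
  rw [extDeriv_apply hσ, Fin.sum_univ_two, e0, e1]
  simp [sub_eq_add_neg]

/-- The `1`-form `z ↦ a z`, as a function with values in alternating maps, is as smooth as `a`. -/
theorem contDiffAt_ofSubsingleton {F : Type*} [NormedAddCommGroup F] [NormedSpace ℝ F]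
    {a : F → F →L[ℝ] ℝ} {z : F} {n : WithTop ℕ∞} (ha : ContDiffAt ℝ n a z) :
    ContDiffAt ℝ n
      (fun z ↦ ContinuousAlternatingMap.ofSubsingleton ℝ F ℝ (0 : Fin 1) (a z)) z :=
  (ContinuousAlternatingMap.ofSubsingletonLIE (𝕜 := ℝ) (E := F) (F := ℝ)
    (0 : Fin 1)).toContinuousLinearEquiv.toContinuousLinearMap.contDiff.contDiffAt.comp z ha

/-! ### Coordinate expressions of `ω_Q` and of `pr₁^* θ_Q - H η`. -/

section CanonicalForms

variable {E : Type*} [NormedAddCommGroup E] [NormedSpace ℝ E]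
  {Q : Type*} [TopologicalSpace Q] [ChartedSpace E Q] [IsManifold 𝓘(ℝ, E) ∞ Q]

theorem contDiffAt_liouvilleForm_inChart (α₀ : CotangentBundle E Q) {z : E × (E →L[ℝ] ℝ)}
    (hz : z ∈ (extChartAt (modelTsQ E) α₀).target) :
    ContDiffAt ℝ ∞ (DiffForm.inChart (liouvilleForm E Q) α₀) z := by
  have h1 : ContDiffAt ℝ ∞ (fun w : E × (E →L[ℝ] ℝ) ↦ w.2 ∘L .fst ℝ E (E →L[ℝ] ℝ)) z := by
    fun_prop
  refine (contDiffAt_ofSubsingleton h1).congr_of_eventuallyEq ?_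
  filter_upwards [(isOpen_extChartAt_target α₀).mem_nhds hz] with w hw
  ext v
  exact liouvilleForm_inChart α₀ hw v

/-- From `θ_Q = p dx` one gets `ω_Q = dx ∧ dp`. The equations `ha` and `hb` let tangent vectors be
treated as elements of the model space. -/
theorem symplecticForm_apply {α₀ α : CotangentBundle E Q}
    (hα : α ∈ (extChartAt (modelTsQ E) α₀).source) (v : Fin 2 → TangentSpace (modelTsQ E) α)
    {a b : E × (E →L[ℝ] ℝ)}
    (ha : mfderiv (modelTsQ E) 𝓘(ℝ, E × (E →L[ℝ] ℝ)) (extChartAt (modelTsQ E) α₀) α (v 0) = a)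
    (hb : mfderiv (modelTsQ E) 𝓘(ℝ, E × (E →L[ℝ] ℝ)) (extChartAt (modelTsQ E) α₀) α (v 1) = b) :
    symplecticForm E Q α v = -(a.2 b.1 - b.2 a.1) := by
  set φ := extChartAt (modelTsQ E) α₀
  have hz : φ α ∈ φ.target := φ.map_source hα
  have hd := (contDiffAt_liouvilleForm_inChart α₀ hz).differentiableAt (by simp)
  have h1 : symplecticForm E Q α v =
      -extDeriv (DiffForm.inChart (liouvilleForm E Q) α₀) (φ α) ![a, b] := by
    change -(DiffForm.extd (liouvilleForm E Q) α v) = _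
    rw [DiffForm.extd_eq _ hα hd]
    change -extDeriv (DiffForm.inChart (liouvilleForm E Q) α₀) (φ α) (fun i ↦ _) = _
    congr 2
    ext1 i
    fin_cases i
    · exact ha
    · exact hb
  have key : ∀ u v : E × (E →L[ℝ] ℝ), fderiv ℝ
      (fun z ↦ DiffForm.inChart (liouvilleForm E Q) α₀ z ![v]) (φ α) u = u.2 v.1 := by
    intro u v
    have h2 : (fun z ↦ DiffForm.inChart (liouvilleForm E Q) α₀ z ![v]) =ᶠ[𝓝 (φ α)]
        ((ContinuousLinearMap.apply ℝ ℝ v.1) ∘L .snd ℝ E (E →L[ℝ] ℝ)) := by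
      filter_upwards [(isOpen_extChartAt_target α₀).mem_nhds hz] with w hw
      exact liouvilleForm_inChart α₀ hw _
    rw [h2.fderiv_eq, ContinuousLinearMap.fderiv]
    rfl
  rw [h1, extDeriv_one_apply hd, key, key]

/-- The `1`-form `pr₁^* θ_Q - H η` on `T^*Q × ℝ`. -/
def cartanForm (H : CotangentBundle E Q × ℝ → ℝ) :
    DiffForm (modelTsQR E) (CotangentBundle E Q × ℝ) 1 := fun z ↦
  DiffForm.pullback (I := modelTsQR E) (Prod.fst : CotangentBundle E Q × ℝ → CotangentBundle E Q)
    (liouvilleForm E Q) z - H z • etaForm E Q z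

theorem extChartAt_cotangent_prod (y : CotangentBundle E Q × ℝ) :
    extChartAt (modelTsQR E) y = (extChartAt (modelTsQ E) y.1).prod (PartialEquiv.refl ℝ) := by
  rw [extChartAt_prod, extChartAt_model_space_eq_id]

theorem cartanForm_inChart (H : CotangentBundle E Q × ℝ → ℝ) (y₀ : CotangentBundle E Q × ℝ)
    {z : (E × (E →L[ℝ] ℝ)) × ℝ} (hz : z ∈ (extChartAt (modelTsQR E) y₀).target)
    (v : Fin 1 → (E × (E →L[ℝ] ℝ)) × ℝ) :
    DiffForm.inChart (cartanForm H) y₀ z v =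
      z.1.2 (v 0).1.1 - H ((extChartAt (modelTsQR E) y₀).symm z) * (v 0).2 := by
  set φ := extChartAt (modelTsQR E) y₀ with hφ
  set ψ := extChartAt (modelTsQ E) y₀.1 with hψ
  have hprod : φ = ψ.prod (PartialEquiv.refl ℝ) := extChartAt_cotangent_prod y₀
  have hz1 : z.1 ∈ ψ.target := by
    rw [hprod] at hz
    exact hz.1
  have hsymm := mdifferentiableAt_extChartAt_symm (I := modelTsQR E) hz
  have h1 : DiffForm.pullback (I := 𝓘(ℝ, (E × (E →L[ℝ] ℝ)) × ℝ)) φ.symm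
      (DiffForm.pullback (I := modelTsQR E)
        (Prod.fst : CotangentBundle E Q × ℝ → CotangentBundle E Q) (liouvilleForm E Q)) z v =
      z.1.2 (v 0).1.1 := by
    have e1 := DiffForm.pullback_comp (I := 𝓘(ℝ, (E × (E →L[ℝ] ℝ)) × ℝ)) (liouvilleForm E Q)
      (f := (Prod.fst : CotangentBundle E Q × ℝ → CotangentBundle E Q)) (g := φ.symm) (x := z)
      mdifferentiableAt_fst hsymm
    have e2 : (Prod.fst : CotangentBundle E Q × ℝ → CotangentBundle E Q) ∘ φ.symm =
        ψ.symm ∘ Prod.fst := by rw [hprod]; rfl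
    have e3 := DiffForm.pullback_comp (I := 𝓘(ℝ, (E × (E →L[ℝ] ℝ)) × ℝ))
      (I' := 𝓘(ℝ, E × (E →L[ℝ] ℝ))) (liouvilleForm E Q) (f := ψ.symm) (g := Prod.fst) (x := z)
      (mdifferentiableAt_extChartAt_symm hz1) differentiableAt_fst.mdifferentiableAt
    rw [← e1, e2, e3]
    change DiffForm.inChart (liouvilleForm E Q) y₀.1 z.1 (fun i ↦ mfderiv
      𝓘(ℝ, (E × (E →L[ℝ] ℝ)) × ℝ) 𝓘(ℝ, E × (E →L[ℝ] ℝ)) Prod.fst z (v i)) = _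
    rw [mfderiv_eq_fderiv, fderiv_fst]
    exact liouvilleForm_inChart y₀.1 hz1 _
  have h2 : DiffForm.pullback (I := 𝓘(ℝ, (E × (E →L[ℝ] ℝ)) × ℝ)) φ.symm
      (etaForm E Q) z v = (v 0).2 := by
    have e1 := DiffForm.pullback_comp (I := 𝓘(ℝ, (E × (E →L[ℝ] ℝ)) × ℝ)) dtForm
      (f := (Prod.snd : CotangentBundle E Q × ℝ → ℝ)) (g := φ.symm) (x := z)
      mdifferentiableAt_snd hsymm
    have e2 : (Prod.snd : CotangentBundle E Q × ℝ → ℝ) ∘ φ.symm = Prod.snd := by rw [hprod]; rfl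
    rw [e2] at e1
    change DiffForm.pullback (I := 𝓘(ℝ, (E × (E →L[ℝ] ℝ)) × ℝ)) φ.symm
      (DiffForm.pullback (Prod.snd : CotangentBundle E Q × ℝ → ℝ) dtForm) z v = _
    rw [← e1]
    change (mfderiv 𝓘(ℝ, (E × (E →L[ℝ] ℝ)) × ℝ) 𝓘(ℝ, ℝ) Prod.snd z (v 0) : ℝ) = _
    rw [mfderiv_eq_fderiv, fderiv_snd]
    rfl
  rw [← h1, ← h2]
  rfl

end CanonicalForms

/-! ### Existence, uniqueness and smoothness of the evolution field. -/

section Evolution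

set_option synthInstance.maxHeartbeats 200000

variable {E : Type*} [NormedAddCommGroup E] [NormedSpace ℝ E]
  {Q : Type*} [TopologicalSpace Q] [ChartedSpace E Q] [IsManifold 𝓘(ℝ, E) ∞ Q]
  {H : CotangentBundle E Q × ℝ → ℝ}

/-- The expression of a function on `T^*Q × ℝ` in the preferred chart at `y₀`. -/
def hamiltonianInChart (H : CotangentBundle E Q × ℝ → ℝ) (y₀ : CotangentBundle E Q × ℝ) :
    (E × (E →L[ℝ] ℝ)) × ℝ → ℝ := H ∘ (extChartAt (modelTsQR E) y₀).symm

theorem contDiffAt_hamiltonianInChart (hH : ContMDiff (modelTsQR E) 𝓘(ℝ, ℝ) ∞ H)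
    (y₀ : CotangentBundle E Q × ℝ) {z : (E × (E →L[ℝ] ℝ)) × ℝ}
    (hz : z ∈ (extChartAt (modelTsQR E) y₀).target) :
    ContDiffAt ℝ ∞ (hamiltonianInChart H y₀) z := by
  have h2 : ContMDiffAt 𝓘(ℝ, (E × (E →L[ℝ] ℝ)) × ℝ) (modelTsQR E) ∞
      (extChartAt (modelTsQR E) y₀).symm z :=
    (contMDiffOn_extChartAt_symm y₀).contMDiffAt ((isOpen_extChartAt_target y₀).mem_nhds hz)
  exact ((hH _).comp z h2).contDiffAt

theorem contDiffAt_cartanForm_inChart (hH : ContMDiff (modelTsQR E) 𝓘(ℝ, ℝ) ∞ H)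
    (y₀ : CotangentBundle E Q × ℝ) {z : (E × (E →L[ℝ] ℝ)) × ℝ}
    (hz : z ∈ (extChartAt (modelTsQR E) y₀).target) :
    ContDiffAt ℝ ∞ (DiffForm.inChart (cartanForm H) y₀) z := by
  have h0 := contDiffAt_hamiltonianInChart hH y₀ hz
  have h1 : ContDiffAt ℝ ∞ (fun w : (E × (E →L[ℝ] ℝ)) × ℝ ↦
      w.1.2 ∘L (.fst ℝ E (E →L[ℝ] ℝ) ∘L .fst ℝ (E × (E →L[ℝ] ℝ)) ℝ) -
        hamiltonianInChart H y₀ w • ContinuousLinearMap.snd ℝ (E × (E →L[ℝ] ℝ)) ℝ) z :=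
    ((contDiffAt_snd.comp z contDiffAt_fst).clm_comp contDiffAt_const).sub
      (h0.smul contDiffAt_const)
  refine (contDiffAt_ofSubsingleton h1).congr_of_eventuallyEq ?_
  filter_upwards [(isOpen_extChartAt_target y₀).mem_nhds hz] with w hw
  ext v
  exact cartanForm_inChart H y₀ hw v

theorem omegaForm_isClosedInCharts (hH : ContMDiff (modelTsQR E) 𝓘(ℝ, ℝ) ∞ H) :
    (omegaForm H).IsClosedInCharts :=
  DiffForm.isClosedInCharts_neg_extd (σ := cartanForm H)
    fun y₀ _ hz ↦ contDiffAt_cartanForm_inChart hH y₀ hz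

theorem omegaForm_apply (hH : ContMDiff (modelTsQR E) 𝓘(ℝ, ℝ) ∞ H)
    {y₀ y : CotangentBundle E Q × ℝ} (hy : y ∈ (extChartAt (modelTsQR E) y₀).source)
    (v w : TangentSpace (modelTsQR E) y) {a b : (E × (E →L[ℝ] ℝ)) × ℝ}
    (ha : mfderiv (modelTsQR E) 𝓘(ℝ, (E × (E →L[ℝ] ℝ)) × ℝ) (extChartAt (modelTsQR E) y₀) y v
      = a)
    (hb : mfderiv (modelTsQR E) 𝓘(ℝ, (E × (E →L[ℝ] ℝ)) × ℝ) (extChartAt (modelTsQR E) y₀) y w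
      = b) :
    omegaForm H y ![v, w] =
      -((a.1.2 b.1.1 - fderiv ℝ (hamiltonianInChart H y₀) (extChartAt (modelTsQR E) y₀ y) a * b.2) -
        (b.1.2 a.1.1 - fderiv ℝ (hamiltonianInChart H y₀) (extChartAt (modelTsQR E) y₀ y) b * a.2))
    := by
  set φ := extChartAt (modelTsQR E) y₀
  have hz : φ y ∈ φ.target := φ.map_source hy
  have hd := (contDiffAt_cartanForm_inChart hH y₀ hz).differentiableAt (by simp)
  have h1 : omegaForm H y ![v, w] = -extDeriv (DiffForm.inChart (cartanForm H) y₀) (φ y) ![a, b] := by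
    change -(DiffForm.extd (cartanForm H) y ![v, w]) = _
    rw [DiffForm.extd_eq _ hy hd]
    change -extDeriv (DiffForm.inChart (cartanForm H) y₀) (φ y) (fun i ↦ _) = _
    congr 2
    ext1 i
    fin_cases i
    · exact ha
    · exact hb
  have key : ∀ u v : (E × (E →L[ℝ] ℝ)) × ℝ, fderiv ℝ
      (fun z ↦ DiffForm.inChart (cartanForm H) y₀ z ![v]) (φ y) u =
        u.1.2 v.1.1 - fderiv ℝ (hamiltonianInChart H y₀) (φ y) u * v.2 := by
    intro u v
    have h2 : (fun z ↦ DiffForm.inChart (cartanForm H) y₀ z ![v]) =ᶠ[𝓝 (φ y)]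
        fun z ↦ ((ContinuousLinearMap.apply ℝ ℝ v.1.1) ∘L .snd ℝ E (E →L[ℝ] ℝ) ∘L
          .fst ℝ (E × (E →L[ℝ] ℝ)) ℝ) z - hamiltonianInChart H y₀ z * v.2 := by
      filter_upwards [(isOpen_extChartAt_target y₀).mem_nhds hz] with w hw
      exact cartanForm_inChart H y₀ hw _
    have h3 := (contDiffAt_hamiltonianInChart hH y₀ hz).differentiableAt (by simp)
    rw [h2.fderiv_eq, ((ContinuousLinearMap.hasFDerivAt _).fun_sub
      (h3.hasFDerivAt.mul_const v.2)).fderiv]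
    simp [mul_comm]
  rw [h1, extDeriv_one_apply hd, key, key]

theorem mfderiv_extChartAt_snd {y₀ y : CotangentBundle E Q × ℝ}
    (hy : y ∈ (extChartAt (modelTsQR E) y₀).source) (v : TangentSpace (modelTsQR E) y) :
    ((mfderiv (modelTsQR E) 𝓘(ℝ, (E × (E →L[ℝ] ℝ)) × ℝ) (extChartAt (modelTsQR E) y₀) y v :
      (E × (E →L[ℝ] ℝ)) × ℝ)).2 = (v : (E × (E →L[ℝ] ℝ)) × ℝ).2 := by
  have h := mfderiv_comp (I := modelTsQR E) (I' := 𝓘(ℝ, (E × (E →L[ℝ] ℝ)) × ℝ))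
    (I'' := 𝓘(ℝ, ℝ)) y (g := Prod.snd) (f := extChartAt (modelTsQR E) y₀)
    differentiableAt_snd.mdifferentiableAt (mdifferentiableAt_extChartAt' hy)
  have e : Prod.snd ∘ extChartAt (modelTsQR E) y₀ =
      (Prod.snd : CotangentBundle E Q × ℝ → ℝ) := by
    rw [extChartAt_cotangent_prod]; rfl
  rw [e, mfderiv_snd, mfderiv_eq_fderiv, fderiv_snd] at h
  exact (congrArg (fun T : ((E × (E →L[ℝ] ℝ)) × ℝ) →L[ℝ] ℝ ↦ T v) h).symm

theorem etaForm_apply (y : CotangentBundle E Q × ℝ) (v : TangentSpace (modelTsQR E) y) :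
    etaForm E Q y ![v] = (v : (E × (E →L[ℝ] ℝ)) × ℝ).2 := by
  change (mfderiv (modelTsQR E) 𝓘(ℝ, ℝ) (Prod.snd : CotangentBundle E Q × ℝ → ℝ) y v : ℝ) = _
  rw [mfderiv_snd]
  rfl

variable [FiniteDimensional ℝ E]

/-- In a canonical chart, the two conditions that define the evolution vector field single out the
vector with components given by Hamilton's equations. -/
theorem evolution_condition_iff (hH : ContMDiff (modelTsQR E) 𝓘(ℝ, ℝ) ∞ H)
    {y₀ y : CotangentBundle E Q × ℝ} (hy : y ∈ (extChartAt (modelTsQR E) y₀).source)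
    (v : TangentSpace (modelTsQR E) y) :
    ((∀ w : TangentSpace (modelTsQR E) y, omegaForm H y ![v, w] = 0) ∧ etaForm E Q y ![v] = 1) ↔
      mfderiv (modelTsQR E) 𝓘(ℝ, (E × (E →L[ℝ] ℝ)) × ℝ) (extChartAt (modelTsQR E) y₀) y v =
        hamiltonVector (fderiv ℝ (hamiltonianInChart H y₀) (extChartAt (modelTsQR E) y₀ y)) := by
  refine Iff.trans ?_ (eq_hamiltonVector_iff _ _)
  rw [etaForm_apply]
  refine and_congr ⟨fun h b ↦ ?_, fun h w ↦ ?_⟩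
    (iff_of_eq (congrArg (· = (1 : ℝ)) (mfderiv_extChartAt_snd hy v).symm))
  -- The chart derivative is onto, so each model vector `b` comes from a tangent vector `w`.
  · have hz := (extChartAt (modelTsQR E) y₀).map_source hy
    have hb := mfderiv_extChartAt_comp_symm (I := modelTsQR E) hz b
    rw [(extChartAt (modelTsQR E) y₀).left_inv hy] at hb
    let w : TangentSpace (modelTsQR E) y := mfderiv 𝓘(ℝ, (E × (E →L[ℝ] ℝ)) × ℝ) (modelTsQR E)
      (extChartAt (modelTsQR E) y₀).symm (extChartAt (modelTsQR E) y₀ y) b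
    have hw : mfderiv (modelTsQR E) 𝓘(ℝ, (E × (E →L[ℝ] ℝ)) × ℝ) (extChartAt (modelTsQR E) y₀) y w
        = b := hb
    exact (omegaForm_apply hH hy v w rfl hw).symm.trans (h w)
  · rw [omegaForm_apply hH hy v w rfl rfl]
    exact h _

/-- The field is an `epsilon` choice, so a vector satisfying its conditions must first be exhibited:
the Hamilton vector transported back by the inverse chart. The equivalence then fixes the chosen
vector in every chart containing `y`. -/
theorem mfderiv_extChartAt_evolutionField (hH : ContMDiff (modelTsQR E) 𝓘(ℝ, ℝ) ∞ H)
    {y₀ y : CotangentBundle E Q × ℝ} (hy : y ∈ (extChartAt (modelTsQR E) y₀).source) :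
    mfderiv (modelTsQR E) 𝓘(ℝ, (E × (E →L[ℝ] ℝ)) × ℝ) (extChartAt (modelTsQR E) y₀) y
      (evolutionField H y) =
        hamiltonVector (fderiv ℝ (hamiltonianInChart H y₀) (extChartAt (modelTsQR E) y₀ y)) := by
  refine (evolution_condition_iff hH hy _).1 (Classical.epsilon_spec (p := fun v ↦
    (∀ w : TangentSpace (modelTsQR E) y, omegaForm H y ![v, w] = 0) ∧ etaForm E Q y ![v] = 1) ?_)
  have hz := (extChartAt (modelTsQR E) y₀).map_source hy
  have hb := mfderiv_extChartAt_comp_symm (I := modelTsQR E) hz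
    (hamiltonVector (fderiv ℝ (hamiltonianInChart H y₀) (extChartAt (modelTsQR E) y₀ y)))
  rw [(extChartAt (modelTsQR E) y₀).left_inv hy] at hb
  exact ⟨_, (evolution_condition_iff hH hy _).2 hb⟩

theorem evolutionField_spec (hH : ContMDiff (modelTsQR E) 𝓘(ℝ, ℝ) ∞ H)
    (y : CotangentBundle E Q × ℝ) :
    (∀ w : TangentSpace (modelTsQR E) y, omegaForm H y ![evolutionField H y, w] = 0) ∧
      etaForm E Q y ![evolutionField H y] = 1 :=
  (evolution_condition_iff hH (mem_extChartAt_source y) _).2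
    (mfderiv_extChartAt_evolutionField hH (mem_extChartAt_source y))

theorem contMDiff_evolutionField (hH : ContMDiff (modelTsQR E) 𝓘(ℝ, ℝ) ∞ H) :
    ContMDiff (modelTsQR E) (modelTsQR E).tangent ∞
      (fun y ↦ (⟨y, evolutionField H y⟩ :
        TangentBundle (modelTsQR E) (CotangentBundle E Q × ℝ))) := by
  intro y₀
  have hy₀ := mem_extChartAt_source (I := modelTsQR E) y₀
  refine (contMDiffAt_vectorField_iff (evolutionField H) hy₀).2 ?_
  have hz := (extChartAt (modelTsQR E) y₀).map_source hy₀
  have h1 : ContDiffAt ℝ ∞ (fun z ↦ hamiltonVector (fderiv ℝ (hamiltonianInChart H y₀) z))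
      (extChartAt (modelTsQR E) y₀ y₀) :=
    (contDiff_hamiltonVector (E := E)).contDiffAt.comp _
      ((contDiffAt_hamiltonianInChart hH y₀ hz).fderiv_right (by simp))
  refine (h1.contMDiffAt.comp y₀ contMDiffAt_extChartAt).congr_of_eventuallyEq ?_
  filter_upwards [extChartAt_source_mem_nhds (I := modelTsQR E) y₀] with y hy
  exact mfderiv_extChartAt_evolutionField hH hy

end Evolution

/-! ### Smoothness of the Hamiltonian, restriction to time slices, and the conclusion. -/

section Hamiltonian

variable {E : Type*} [NormedAddCommGroup E] [NormedSpace ℝ E]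
  {Q : Type*} [TopologicalSpace Q] [ChartedSpace E Q] [IsManifold 𝓘(ℝ, E) ∞ Q]

/-- The Legendre map coincides with a diffeomorphism, so the fibre derivative is smooth as a
covector field along the projection to `Q`. Pairing it with the velocity keeps smoothness. -/
theorem contMDiff_energy {L : TangentBundle 𝓘(ℝ, E) Q × ℝ → ℝ}
    (hLsmooth : ContMDiff (modelTQR E) 𝓘(ℝ, ℝ) ∞ L) (hL : IsHyperregular L) :
    ContMDiff (modelTQR E) 𝓘(ℝ, ℝ) ∞ (energy L) := by
  have : IsManifold 𝓘(ℝ, E) (∞ + 1) Q := ‹IsManifold 𝓘(ℝ, E) ∞ Q›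
  obtain ⟨Φ, hΦ⟩ := hL
  have h1 : ContMDiff (modelTQR E) (modelTsQ E) ∞ (fun z ↦ (legendre L z).1) := by
    have := contMDiff_fst.comp Φ.contMDiff
    refine this.congr fun z ↦ ?_
    simp [hΦ]
  have h2 : ContMDiff (modelTQR E) 𝓘(ℝ, E).tangent ∞
      (fun z : TangentBundle 𝓘(ℝ, E) Q × ℝ ↦ z.1) := contMDiff_fst
  have h3 := ContMDiff.clm_bundle_apply (IB := 𝓘(ℝ, E)) (F₁ := E) (F₂ := ℝ)
    (E₁ := (TangentSpace 𝓘(ℝ, E) : Q → Type _)) (E₂ := Bundle.Trivial Q ℝ)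
    (b := fun z : TangentBundle 𝓘(ℝ, E) Q × ℝ ↦ z.1.proj)
    (ϕ := fun z ↦ fibreDeriv L z) (v := fun z ↦ z.1.snd) h1 h2
  have h4 : ContMDiff (modelTQR E) 𝓘(ℝ, ℝ) ∞
      (fun z : TangentBundle 𝓘(ℝ, E) Q × ℝ ↦ fibreDeriv L z z.1.snd) := fun z ↦
    (Bundle.contMDiffAt_totalSpace.1 (h3 z)).2
  exact h4.sub hLsmooth

theorem contMDiff_hamiltonian {L : TangentBundle 𝓘(ℝ, E) Q × ℝ → ℝ}
    (hLsmooth : ContMDiff (modelTQR E) 𝓘(ℝ, ℝ) ∞ L) (hL : IsHyperregular L) :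
    ContMDiff (modelTsQR E) 𝓘(ℝ, ℝ) ∞ (hamiltonian L hL) :=
  (contMDiff_energy hLsmooth hL).comp (Classical.choose hL).symm.contMDiff

theorem mfderiv_extChartAt_self_apply {F : Type*} [NormedAddCommGroup F] [NormedSpace ℝ F]
    {H : Type*} [TopologicalSpace H] (I : ModelWithCorners ℝ F H)
    {M : Type*} [TopologicalSpace M] [ChartedSpace H M] [IsManifold I ∞ M] (x : M)
    (v : TangentSpace I x) : mfderiv I 𝓘(ℝ, F) (extChartAt I x) x v = v := by
  have : IsManifold I 1 M := IsManifold.of_le (n := ∞) (by simp)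
  exact congrArg (fun T : F →L[ℝ] F ↦ T v) (mfderiv_extChartAt_self (I := I) (x := x))

/-- Vectors tangent to a slice have no time component, so `dH ∧ dt` drops out and `dx ∧ dp` remains.
-/
theorem pullback_omegaForm {H : CotangentBundle E Q × ℝ → ℝ}
    (hH : ContMDiff (modelTsQR E) 𝓘(ℝ, ℝ) ∞ H) (t : ℝ) :
    DiffForm.pullback (I := modelTsQ E) (fun α : CotangentBundle E Q ↦ (α, t)) (omegaForm H) =
      symplecticForm E Q := by
  funext α
  ext v
  let w : Fin 2 → TangentSpace (modelTsQR E) ((α, t) : CotangentBundle E Q × ℝ) := fun i ↦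
    mfderiv (modelTsQ E) (modelTsQR E) (fun α : CotangentBundle E Q ↦ (α, t)) α (v i)
  have hw : ∀ i, (w i : (E × (E →L[ℝ] ℝ)) × ℝ) = ((v i : E × (E →L[ℝ] ℝ)), 0) := by
    intro i
    have := mfderiv_prod_left (I := modelTsQ E) (I' := 𝓘(ℝ, ℝ)) (x₀ := α) (y₀ := t)
    exact congrArg (fun T : (E × (E →L[ℝ] ℝ)) →L[ℝ] (E × (E →L[ℝ] ℝ)) × ℝ ↦ T (v i)) this
  have e1 := omegaForm_apply hH (mem_extChartAt_source (I := modelTsQR E)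
    ((α, t) : CotangentBundle E Q × ℝ)) (w 0) (w 1)
    ((mfderiv_extChartAt_self_apply (modelTsQR E) _ _).trans (hw 0))
    ((mfderiv_extChartAt_self_apply (modelTsQR E) _ _).trans (hw 1))
  have e2 := symplecticForm_apply (mem_extChartAt_source (I := modelTsQ E) α) v
    (mfderiv_extChartAt_self_apply (modelTsQ E) _ _)
    (mfderiv_extChartAt_self_apply (modelTsQ E) _ _)
  rw [e2]
  have e3 : w = ![w 0, w 1] := by ext1 i; fin_cases i <;> rfl
  change omegaForm H (α, t) w = _
  rw [e3, e1]
  simp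

theorem contMDiffAt_prodMk_left (t : ℝ) (α : CotangentBundle E Q) :
    ContMDiffAt (modelTsQ E) (modelTsQR E) ∞ (fun β : CotangentBundle E Q ↦ (β, t)) α :=
  contMDiffAt_id.prodMk contMDiffAt_const

variable [FiniteDimensional ℝ E]

/-- The condition `i_{E_H} η = 1` says that the time coordinate has derivative `1` along the curve.
-/
theorem evolution_curve_snd {H : CotangentBundle E Q × ℝ → ℝ}
    (hH : ContMDiff (modelTsQR E) 𝓘(ℝ, ℝ) ∞ H) {γ : ℝ → CotangentBundle E Q × ℝ} {a b : ℝ}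
    (hγ : IsMIntegralCurveOn γ (evolutionField H) (Ioo a b)) (h0 : (0 : ℝ) ∈ Ioo a b)
    {τ : ℝ} (hτ : τ ∈ Ioo a b) : (γ τ).2 = (γ 0).2 + τ := by
  have hd : ∀ σ ∈ Ioo a b, HasDerivAt (fun τ ↦ (γ τ).2 - τ) 0 σ := by
    intro σ hσ
    have h1 := (hγ σ hσ).hasMFDerivAt (Ioo_mem_nhds hσ.1 hσ.2)
    have h2 := (hasMFDerivAt_snd (I := modelTsQ E) (I' := 𝓘(ℝ, ℝ)) (γ σ)).comp σ h1
    have h3 : HasFDerivAt (fun τ ↦ (γ τ).2)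
        ((ContinuousLinearMap.snd ℝ (E × (E →L[ℝ] ℝ)) ℝ).comp ((1 : ℝ →L[ℝ] ℝ).smulRight
          (evolutionField H (γ σ) : (E × (E →L[ℝ] ℝ)) × ℝ))) σ := h2.hasFDerivAt
    have h4 : ((evolutionField H (γ σ) : (E × (E →L[ℝ] ℝ)) × ℝ)).2 = 1 := by
      rw [← etaForm_apply, (evolutionField_spec hH _).2]
    have h5 := (h3.hasDerivAt.congr_deriv (f' := _) (g' := 1) (by
      change ((1 : ℝ) • (evolutionField H (γ σ) : (E × (E →L[ℝ] ℝ)) × ℝ)).2 = 1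
      rw [one_smul, h4])).fun_sub (hasDerivAt_id' σ)
    rw [sub_self] at h5
    exact h5
  have := isOpen_Ioo.is_const_of_deriv_eq_zero isPreconnected_Ioo
    (fun σ hσ ↦ (hd σ hσ).differentiableAt.differentiableWithinAt) (fun σ hσ ↦ (hd σ hσ).deriv)
    hτ h0
  simp only [sub_zero] at this
  linarith

variable [T2Space Q] {H : CotangentBundle E Q × ℝ → ℝ}

theorem flow_evolutionField_eq (hH : ContMDiff (modelTsQR E) 𝓘(ℝ, ℝ) ∞ H) {t s : ℝ}
    {α : CotangentBundle E Q} (hα : α ∈ fibreDomain H t s) :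
    flow (evolutionField H) s (α, t) = (fibreFlow H t s α, t + s) := by
  have : CompleteSpace ((E × (E →L[ℝ] ℝ)) × ℝ) := inferInstance
  obtain ⟨γ, a, b, h0, hs, hγ0, hγ⟩ := id hα
  have h1 := (flow_eq_of_isMIntegralCurveOn (contMDiff_evolutionField hH) hγ h0 hs).2
  rw [sub_zero, hγ0] at h1
  have h2 := evolution_curve_snd hH hγ h0 hs
  rw [hγ0] at h2
  exact Prod.ext rfl ((congrArg Prod.snd h1).trans h2)

theorem fibreFlow_neg (hH : ContMDiff (modelTsQR E) 𝓘(ℝ, ℝ) ∞ H) {t s : ℝ}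
    {α : CotangentBundle E Q} (hα : α ∈ fibreDomain H t s) :
    fibreFlow H t s α ∈ fibreDomain H (t + s) (-s) ∧
      fibreFlow H (t + s) (-s) (fibreFlow H t s α) = α := by
  have h := flow_neg (contMDiff_evolutionField hH) (show (α, t) ∈ _ from hα)
  rw [flow_evolutionField_eq hH hα] at h
  exact ⟨h.1, congrArg Prod.fst h.2⟩

theorem eventually_fibreDomain (hH : ContMDiff (modelTsQR E) 𝓘(ℝ, ℝ) ∞ H) {t s : ℝ}
    {α : CotangentBundle E Q} (hα : α ∈ fibreDomain H t s) :
    ∀ᶠ β in 𝓝 α, FlowPreservesAt (evolutionField H) (omegaForm H) s (β, t) := by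
  have h := eventually_flowPreservesAt (contMDiff_evolutionField hH)
    (omegaForm_isClosedInCharts hH) (fun y w ↦ (evolutionField_spec hH y).1 w) hα
  exact (Continuous.prodMk_left t).continuousAt.eventually h

theorem isOpen_fibreDomain (hH : ContMDiff (modelTsQR E) 𝓘(ℝ, ℝ) ∞ H) (t s : ℝ) :
    IsOpen (fibreDomain H t s) :=
  isOpen_iff_mem_nhds.2 fun _ hα ↦ (eventually_fibreDomain hH hα).mono fun _ h ↦ h.1

theorem contMDiffAt_fibreFlow (hH : ContMDiff (modelTsQR E) 𝓘(ℝ, ℝ) ∞ H) {t s : ℝ}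
    {α : CotangentBundle E Q} (hα : α ∈ fibreDomain H t s) :
    ContMDiffAt (modelTsQ E) (modelTsQ E) ∞ (fibreFlow H t s) α :=
  contMDiffAt_fst.comp α
    ((eventually_fibreDomain hH hα).self_of_nhds.2.1.comp α (contMDiffAt_prodMk_left t α))

/-- Both sides of `j_{t+s} ∘ Ψ_{t,s} = Ψ_s ∘ j_t` pull `Ω_H` back to the same form: the left gives
`Ψ_{t,s}^* ω_Q`, and the right gives `j_t^* Ω_H = ω_Q` by invariance of `Ω_H`. -/
theorem pullback_fibreFlow (hH : ContMDiff (modelTsQR E) 𝓘(ℝ, ℝ) ∞ H) {t s : ℝ}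
    {α : CotangentBundle E Q} (hα : α ∈ fibreDomain H t s) :
    DiffForm.pullback (I := modelTsQ E) (fibreFlow H t s) (symplecticForm E Q) α =
      symplecticForm E Q α := by
  have hflow := (eventually_fibreDomain hH hα).self_of_nhds.2
  have heq : (fun β : CotangentBundle E Q ↦ (β, t + s)) ∘ fibreFlow H t s =ᶠ[𝓝 α]
      flow (evolutionField H) s ∘ fun β : CotangentBundle E Q ↦ (β, t) := by
    filter_upwards [(isOpen_fibreDomain hH t s).mem_nhds hα] with β hβ
      using (flow_evolutionField_eq hH hβ).symm
  have e1 := DiffForm.pullback_comp (I := modelTsQ E) (I' := modelTsQ E) (omegaForm H)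
    (f := fun β : CotangentBundle E Q ↦ (β, t + s)) (g := fibreFlow H t s) (x := α)
    ((contMDiffAt_prodMk_left (t + s) _).mdifferentiableAt (by simp))
    ((contMDiffAt_fibreFlow hH hα).mdifferentiableAt (by simp))
  have e2 := DiffForm.pullback_comp (I := modelTsQ E) (I' := modelTsQR E) (omegaForm H)
    (f := flow (evolutionField H) s) (g := fun β : CotangentBundle E Q ↦ (β, t)) (x := α)
    (hflow.1.mdifferentiableAt (by simp))
    ((contMDiffAt_prodMk_left t α).mdifferentiableAt (by simp))
  rw [pullback_omegaForm hH, DiffForm.pullback_congr _ heq, e2] at e1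
  rw [← e1, ← pullback_omegaForm hH t]
  ext v
  exact congrArg (fun T : ((E × (E →L[ℝ] ℝ)) × ℝ) [⋀^Fin 2]→L[ℝ] ℝ ↦
    T (fun i ↦ (mfderiv (modelTsQ E) (modelTsQR E) (fun β : CotangentBundle E Q ↦ (β, t)) α :
      (E × (E →L[ℝ] ℝ)) →L[ℝ] (E × (E →L[ℝ] ℝ)) × ℝ) (v i))) hflow.2

/-- The image is exactly the fibre domain for start time `t + s` and duration `-s`, so its openness
and the smoothness of the inverse are instances of the results already proved for the forward map.
-/
theorem isSymplectomorphismOn_fibreFlow (hH : ContMDiff (modelTsQR E) 𝓘(ℝ, ℝ) ∞ H) (t s : ℝ) :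
    IsSymplectomorphismOn (modelTsQ E) (symplecticForm E Q) (fibreFlow H t s)
      (fibreDomain H t s) := by
  have hback : ∀ β ∈ fibreDomain H (t + s) (-s), fibreFlow H (t + s) (-s) β ∈ fibreDomain H t s ∧
      fibreFlow H t s (fibreFlow H (t + s) (-s) β) = β := by
    intro β hβ
    have := fibreFlow_neg hH hβ
    rwa [neg_neg, add_neg_cancel_right] at this
  refine ⟨⟨{ toFun := fibreFlow H t s
             invFun := fibreFlow H (t + s) (-s)
             source := fibreDomain H t s
             target := fibreDomain H (t + s) (-s)
             map_source' := fun α hα ↦ (fibreFlow_neg hH hα).1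
             map_target' := fun β hβ ↦ (hback β hβ).1
             left_inv' := fun α hα ↦ (fibreFlow_neg hH hα).2
             right_inv' := fun β hβ ↦ (hback β hβ).2
             open_source := isOpen_fibreDomain hH t s
             open_target := isOpen_fibreDomain hH (t + s) (-s)
             continuousOn_toFun := fun α hα ↦
              (contMDiffAt_fibreFlow hH hα).continuousAt.continuousWithinAt
             continuousOn_invFun := fun β hβ ↦
              (contMDiffAt_fibreFlow hH hβ).continuousAt.continuousWithinAt }, rfl,
    fun _ _ ↦ rfl, fun α hα ↦ (contMDiffAt_fibreFlow hH hα).contMDiffWithinAt,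
    fun β hβ ↦ (contMDiffAt_fibreFlow hH hβ).contMDiffWithinAt⟩,
    fun α hα ↦ pullback_fibreFlow hH hα⟩

end Hamiltonian

end

theorem mainTheorem2
    {E : Type*} [NormedAddCommGroup E] [NormedSpace ℝ E] [FiniteDimensional ℝ E]
    {Q : Type*} [TopologicalSpace Q] [ChartedSpace E Q] [IsManifold 𝓘(ℝ, E) ∞ Q] [T2Space Q]
    (L : TangentBundle 𝓘(ℝ, E) Q × ℝ → ℝ)
    (hLsmooth : ContMDiff (modelTQR E) 𝓘(ℝ, ℝ) ∞ L)
    (hL : IsHyperregular L) (t s : ℝ) :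
    IsSymplectomorphismOn (modelTsQ E) (symplecticForm E Q)
      (fibreFlow (hamiltonian L hL) t s) (fibreDomain (hamiltonian L hL) t s) :=
  isSymplectomorphismOn_fibreFlow (contMDiff_hamiltonian hLsmooth hL) t s
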